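/- **Setting.** Let $A\in\mathbb R^{n\times n}$, $C\in\mathbb R^{m\times n}$. Let $\bar{\mathcal G}_1,\dots,\bar{\mathcal G}_{n_0}$ be directed graphs without self-loops on the nodes $0$ (the leader) and $1,\dots,N$ (the followers), and let $\sigma:[0,\infty)\to\{1,\dots,n_0\}$ be a switching signal with switching instants $0=t_0<t_1<\cdots$ and dwell time $\tau>0$: $t_{j+1}-t_j\ge\tau$, and $\sigma$ is constant on each $[t_j,t_{j+1})$. Put $a_{ij}(t)=1$ if $(j,i)$ is an edge of $\bar{\mathcal G}_{\sigma(t)}$ (an edge from $j$ to $i$) and $a_{ij}(t)=0$ otherwise. Let $\mathcal L_{\sigma(t)}$ be the Laplacian of the subgraph $\mathcal G_{\sigma(t)}$ induced on $\{1,\dots,N\}$ (diagonal entries $\sum_{j=1}^N a_{ij}(t)$, off-diagonal entries $-a_{ij}(t)$), let $\mathcal H_{\sigma(t)}=\mathcal L_{\sigma(t)}+\mathrm{diag}\{a_{10}(t),\dots,a_{N0}(t)\}$, and let $P_{\sigma(t)}$ be the orthogonal projection of $\mathbb R^N$ onto $\ker\mathcal H_{\sigma(t)}$. **Assumptions.**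 (i) $\mathcal G_{\sigma(t)}$ is undirected for all $t\ge0$. (ii) There are $T_{\mathrm c}>0$ and a subsequence $(t_{j_k})_{k\ge0}$ of $(t_j)$ with $t_{j_0}=0$ and $t_{j_{k+1}}-t_{j_k}\le T_{\mathrm c}$ such that, for every $k$, every node $i=1,\dots,N$ is reachable from node $0$ in the union graph $\bigcup_{t_j\in[t_{j_k},t_{j_{k+1}})}\bar{\mathcal G}_{\sigma(t_j)}$. (iii) $(C,A)$ is observable. **Theorem.** There is a number $0<\delta<1$ such that $$\big\|P_{\sigma(t_{j_{k+1}-1})}\cdots P_{\sigma(t_{j_k+1})}P_{\sigma(t_{j_k})}\big\|\le\delta\qquad\text{for all } k=0,1,2,\dots\qquad(1)$$ (spectral norm), and for all $\alpha,t^*>0$ the weighted observability Gramian $$W_{\mathrm o}(\alpha,t^*)=\int_0^{t^*}e^{-\alpha t}\,e^{-\frac{A^T}{2}t}\,C^TC\,e^{-\frac A2t}\,dt$$ is positive definite. For every $\delta\in(0,1)$ with (1), if $$\lambda_{\max}(A)<-\frac{\ln\delta}{T_{\mathrm c}},$$ where $\lambda_{\max}(A)$ is the largest real part of the eigenvalues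 of $A$, then there is a gain $L\in\mathbb R^{n\times m}$ that solves the output-based distributed observer problem: for all $x_0(0),\eta_1(0),\dots,\eta_N(0)\in\mathbb R^n$ the system $$\dot x_0=Ax_0,\qquad \dot\eta_i=A\eta_i+LC\sum_{j=0}^N a_{ij}(t)(\eta_j-\eta_i),\quad i=1,\dots,N,\qquad \eta_0=x_0,$$ has a solution on $[0,\infty)$, and there are $M,\rho>0$, independent of the initial conditions, such that every solution satisfies $\|\eta_i(t)-x_0(t)\|\le M e^{-\rho t}\big(\sum_{k=1}^N\|\eta_k(0)-x_0(0)\|^2\big)^{1/2}$ for all $i=1,\dots,N$ and $t\ge0$. More precisely, for every $t^*>0$ there is $\alpha_0>0$ such that, for all $\alpha>\alpha_0$ and all $\mu\ge 1/\lambda_H$ with $\lambda_H=\frac{4}{N(N^2-N+4)}$, the gain $L=\mu W_{\mathrm o}^{-1}(\alpha,t^*)C^T$ solves this problem. -/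

import Mathlib

open Set Filter Topology

noncomputable section

namespace SwitchedObserver

/-! ### Graphs

A graph on `V` is a `Digraph V`; `G.Adj j i` means that `(j, i)` is an edge from `j` to `i`.
In a leader-follower graph, on the nodes `Fin (N + 1)`, node `0` is the leader and
the nodes `i.succ` with `i : Fin N` are the followers. -/

/-- Self-loops are not edges. -/
def Loopless {V : Type*} (G : Digraph V) : Prop :=
  ∀ i, ¬ G.Adj i i

/-- Every edge can be traversed in both directions. -/
def Undirected {V : Type*} (G : Digraph V) : Prop :=
  ∀ i j, G.Adj i j → G.Adj j i

/-- Node `i` is reachable from node `j`: there is a directed path from `j` to `i`. -/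
def Reachable {V : Type*} (G : Digraph V) (j i : V) : Prop :=
  Relation.ReflTransGen G.Adj j i

open Classical in
/-- The adjacency matrix: `a i j = 1` if `(j, i)` is an edge, and `a i j = 0` otherwise. -/
def adjacency {V : Type*} (G : Digraph V) : Matrix V V ℝ :=
  Matrix.of fun i j => if G.Adj j i then 1 else 0

/-- The Laplacian: `l i i = ∑ j, a i j` and `l i j = - a i j` for `i ≠ j`. -/
def laplacian {V : Type*} [Fintype V] [DecidableEq V] (G : Digraph V) : Matrix V V ℝ :=
  Matrix.of fun i j => if i = j then ∑ k, adjacency G i k else - adjacency G i j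

/-- The subgraph induced on the followers. -/
def followerGraph {N : ℕ} (G : Digraph (Fin (N + 1))) : Digraph (Fin N) where
  Adj j i := G.Adj j.succ i.succ

/-- The leader-follower matrix `H = L + diag (a₁₀, …, a_N₀)`, with `L` the Laplacian of the
follower subgraph. -/
def leaderFollowerMatrix {N : ℕ} (G : Digraph (Fin (N + 1))) : Matrix (Fin N) (Fin N) ℝ :=
  laplacian (followerGraph G) + Matrix.diagonal fun i => adjacency G i.succ 0

/-- The orthogonal projection of `ℝ^N` onto the kernel of the leader-follower matrix. -/
def kerProjection {N : ℕ} (G : Digraph (Fin (N + 1))) :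
    EuclideanSpace ℝ (Fin N) →L[ℝ] EuclideanSpace ℝ (Fin N) :=
  (LinearMap.ker (Matrix.toEuclideanLin (leaderFollowerMatrix G))).starProjection

/-! ### Switching networks -/

/-- `σ`, restricted to `[0, ∞)`, is a piecewise constant switching signal with switching
instants `0 = t 0 < t 1 < ⋯` and dwell time `τ`. -/
structure IsSwitchingSignal {n₀ : ℕ} (σ : ℝ → Fin n₀) (t : ℕ → ℝ) (τ : ℝ) : Prop where
  zero : t 0 = 0
  dwell_pos : 0 < τ
  dwell : ∀ j, τ ≤ t (j + 1) - t j
  const : ∀ j, ∀ s ∈ Ico (t j) (t (j + 1)), σ s = σ (t j)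

/-- Along the subsequence `t (j 0), t (j 1), …` of the switching instants, which starts at `0` and
whose gaps are at most `Tc`, every follower is reachable from the leader in the union of the
graphs that are active on `[t (j k), t (j (k + 1)))`, for every `k`. -/
structure JointlyConnected {N n₀ : ℕ} (G : Fin n₀ → Digraph (Fin (N + 1))) (σ : ℝ → Fin n₀)
    (t : ℕ → ℝ) (j : ℕ → ℕ) (Tc : ℝ) : Prop where
  strictMono : StrictMono j
  zero : t (j 0) = 0
  Tc_pos : 0 < Tc
  gap : ∀ k, t (j (k + 1)) - t (j k) ≤ Tc
  reachable : ∀ k, ∀ i : Fin N,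
    Reachable (⨆ r : {r : ℕ // t r ∈ Ico (t (j k)) (t (j (k + 1)))}, G (σ (t r))) 0 i.succ

/-- The ordered product `P (a + len - 1) * ⋯ * P (a + 1) * P a` of `len` factors. -/
def orderedProd {M : Type*} [Monoid M] (P : ℕ → M) (a : ℕ) : ℕ → M
  | 0 => 1
  | len + 1 => P (a + len) * orderedProd P a len

/-- `0 < δ < 1`, and `δ` bounds the operator norms of all the products
`P_{σ(t (j (k+1) - 1))} ⋯ P_{σ(t (j k))}` of projections onto the kernels of the leader-follower
matrices. -/
def IsContractionFactor {N n₀ : ℕ} (G : Fin n₀ → Digraph (Fin (N + 1))) (σ : ℝ → Fin n₀)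
    (t : ℕ → ℝ) (j : ℕ → ℕ) (δ : ℝ) : Prop :=
  0 < δ ∧ δ < 1 ∧
    ∀ k, ‖orderedProd (fun r => kerProjection (G (σ (t r)))) (j k) (j (k + 1) - j k)‖ ≤ δ

/-! ### The leader system and the observer gain -/

/-- The largest real part of the (complex) eigenvalues of `A`. -/
def lambdaMax {n : ℕ} (A : Matrix (Fin n) (Fin n) ℝ) : ℝ :=
  sSup (Complex.re '' spectrum ℂ (A.map (algebraMap ℝ ℂ)))

/-- The pair `(C, A)` is observable: the output `C e^{tA} x`, `t ≥ 0`, of `x' = A x` determines the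
initial state `x`. -/
def Observable {n m : ℕ} (C : Matrix (Fin m) (Fin n) ℝ) (A : Matrix (Fin n) (Fin n) ℝ) : Prop :=
  ∀ x y : Fin n → ℝ,
    (∀ t : ℝ, 0 ≤ t →
      C.mulVec ((NormedSpace.exp (t • A)).mulVec x)
        = C.mulVec ((NormedSpace.exp (t • A)).mulVec y)) →
    x = y

/-- The weighted observability Gramian
`∫₀^{tstar} e^{-αt} e^{-(t/2)Aᵀ} Cᵀ C e^{-(t/2)A} dt`, entry by entry. -/
def weightedGramian {n m : ℕ} (A : Matrix (Fin n) (Fin n) ℝ) (C : Matrix (Fin m) (Fin n) ℝ)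
    (α tstar : ℝ) : Matrix (Fin n) (Fin n) ℝ :=
  Matrix.of fun i k => ∫ t in (0 : ℝ)..tstar,
    (Real.exp (-α * t) •
      (NormedSpace.exp (-(t / 2) • A.transpose) * C.transpose * C *
        NormedSpace.exp (-(t / 2) • A))) i k

/-- The gain `L = μ W⁻¹ Cᵀ`, with `W` the weighted observability Gramian. -/
def observerGain {n m : ℕ} (A : Matrix (Fin n) (Fin n) ℝ) (C : Matrix (Fin m) (Fin n) ℝ)
    (μ α tstar : ℝ) : Matrix (Fin n) (Fin m) ℝ :=
  μ • ((weightedGramian A C α tstar)⁻¹ * C.transpose)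

/-- `λ_H = 4 / (N (N² - N + 4))`. -/
def lambdaH (N : ℕ) : ℝ :=
  4 / ((N : ℝ) * ((N : ℝ) ^ 2 - N + 4))

/-! ### The observer -/

/-- `x₀` and `η₁, …, η_N` solve, on `[0, ∞)`, the leader system `x₀' = A x₀` and the observer
`ηᵢ' = A ηᵢ + L C ∑_{j=0}^N a_ij(t) (η_j - ηᵢ)`, where `η₀ = x₀`.
As `σ` is right-continuous with jumps at the switching instants, a solution of the switched
equations is a continuous function whose right derivative satisfies the equations at all times. -/
structure IsObserverSolution {n m N n₀ : ℕ} (A : Matrix (Fin n) (Fin n) ℝ)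
    (C : Matrix (Fin m) (Fin n) ℝ) (G : Fin n₀ → Digraph (Fin (N + 1))) (σ : ℝ → Fin n₀)
    (L : Matrix (Fin n) (Fin m) ℝ) (x₀ : ℝ → EuclideanSpace ℝ (Fin n))
    (η : Fin N → ℝ → EuclideanSpace ℝ (Fin n)) : Prop where
  leader : ∀ s, 0 ≤ s → HasDerivWithinAt x₀ (Matrix.toEuclideanLin A (x₀ s)) (Ici 0) s
  continuousOn : ∀ i, ContinuousOn (η i) (Ici 0)
  observer : ∀ i, ∀ s, 0 ≤ s →
    HasDerivWithinAt (η i)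
      (Matrix.toEuclideanLin A (η i s) + Matrix.toEuclideanLin (L * C)
        (∑ j : Fin (N + 1), adjacency (G (σ s)) i.succ j •
          ((Fin.cons x₀ η : Fin (N + 1) → ℝ → EuclideanSpace ℝ (Fin n)) j s - η i s)))
      (Ici s) s

/-- The gain `L` solves the observer design problem: for all initial conditions a solution exists
on `[0, ∞)`, and along all solutions the estimation errors `ηᵢ - x₀` decay exponentially, with
constants `M` and `ρ` that do not depend on the initial conditions. -/
def SolvesObserverProblem {n m N n₀ : ℕ} (A : Matrix (Fin n) (Fin n) ℝ)
    (C : Matrix (Fin m) (Fin n) ℝ) (G : Fin n₀ → Digraph (Fin (N + 1))) (σ : ℝ → Fin n₀)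
    (L : Matrix (Fin n) (Fin m) ℝ) : Prop :=
  (∀ (x₀init : EuclideanSpace ℝ (Fin n)) (ηinit : Fin N → EuclideanSpace ℝ (Fin n)),
    ∃ x₀ η, IsObserverSolution A C G σ L x₀ η ∧ x₀ 0 = x₀init ∧ ∀ i, η i 0 = ηinit i) ∧
  ∃ M ρ : ℝ, 0 < M ∧ 0 < ρ ∧
    ∀ x₀ η, IsObserverSolution A C G σ L x₀ η →
      ∀ i, ∀ s, 0 ≤ s →
        ‖η i s - x₀ s‖ ≤ M * Real.exp (-ρ * s) * √(∑ k, ‖η k 0 - x₀ 0‖ ^ 2)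

end SwitchedObserver

end

noncomputable section

namespace SwitchedObserver
open scoped Matrix
open NormedSpace (exp)

lemma adjacency_nonneg {V : Type*} (G : Digraph V) (i j : V) : 0 ≤ adjacency G i j := by
  unfold adjacency; simp only [Matrix.of_apply]; split_ifs <;> simp

lemma adjacency_of_adj {V : Type*} {G : Digraph V} {i j : V} (h : G.Adj j i) :
    adjacency G i j = 1 := by
  simp [adjacency, h]

lemma adjacency_of_not_adj {V : Type*} {G : Digraph V} {i j : V} (h : ¬ G.Adj j i) :
    adjacency G i j = 0 := by
  simp [adjacency, h]

lemma Undirected.adjacency_comm {V : Type*} {G : Digraph V} (h : Undirected G) (i j : V) :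
    adjacency G i j = adjacency G j i := by
  by_cases hij : G.Adj j i
  · rw [adjacency_of_adj hij, adjacency_of_adj (h _ _ hij)]
  · rw [adjacency_of_not_adj hij, adjacency_of_not_adj fun h' => hij (h _ _ h')]

lemma Loopless.followerGraph {N : ℕ} {G : Digraph (Fin (N + 1))} (h : Loopless G) :
    Loopless (followerGraph G) := fun i => h i.succ

lemma adjacency_followerGraph {N : ℕ} (G : Digraph (Fin (N + 1))) (i j : Fin N) :
    adjacency (followerGraph G) i j = adjacency G i.succ j.succ := rfl

lemma laplacian_mulVec {V : Type*} [Fintype V] [DecidableEq V] {G : Digraph V} (h : Loopless G)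
    (x : V → ℝ) (i : V) :
    (laplacian G *ᵥ x) i = ∑ k, adjacency G i k * (x i - x k) := by
  have key : ∀ k, laplacian G i k * x k =
      (if i = k then (∑ l, adjacency G i l) * x i else 0) - adjacency G i k * x k := by
    intro k
    by_cases hik : i = k
    · subst hik; simp [laplacian, adjacency_of_not_adj (h i)]
    · simp [laplacian, hik]
  simp only [Matrix.mulVec, dotProduct, key, Finset.sum_sub_distrib, Finset.sum_ite_eq,
    Finset.mem_univ, if_true, mul_sub, Finset.sum_mul]

lemma leaderFollowerMatrix_mulVec {N : ℕ} {G : Digraph (Fin (N + 1))} (h : Loopless G)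
    (x : Fin N → ℝ) (i : Fin N) :
    (leaderFollowerMatrix G *ᵥ x) i =
      ∑ k, adjacency (followerGraph G) i k * (x i - x k) + adjacency G i.succ 0 * x i := by
  rw [leaderFollowerMatrix, Matrix.add_mulVec, Pi.add_apply, laplacian_mulVec h.followerGraph,
    Matrix.mulVec_diagonal]

/-- The energy of `x` on the edges with both ends in `S`. -/
def edgeEnergy {V : Type*} (G : Digraph V) (x : V → ℝ) (S : Finset V) : ℝ :=
  (∑ i ∈ S, ∑ k ∈ S, adjacency G i k * (x i - x k) ^ 2) / 2

lemma edgeEnergy_nonneg {V : Type*} (G : Digraph V) (x : V → ℝ) (S : Finset V) :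
    0 ≤ edgeEnergy G x S :=
  div_nonneg (Finset.sum_nonneg fun _ _ => Finset.sum_nonneg fun _ _ =>
    mul_nonneg (adjacency_nonneg _ _ _) (sq_nonneg _)) (by norm_num)

lemma edgeEnergy_le_univ {V : Type*} [Fintype V] (G : Digraph V) (x : V → ℝ) (S : Finset V) :
    edgeEnergy G x S ≤ edgeEnergy G x Finset.univ := by
  have hn : ∀ i k, 0 ≤ adjacency G i k * (x i - x k) ^ 2 := fun i k =>
    mul_nonneg (adjacency_nonneg _ _ _) (sq_nonneg _)
  unfold edgeEnergy
  gcongr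
  calc _ ≤ ∑ i ∈ S, ∑ k, adjacency G i k * (x i - x k) ^ 2 :=
        Finset.sum_le_sum fun i _ => Finset.sum_le_sum_of_subset_of_nonneg (Finset.subset_univ _)
          fun k _ _ => hn i k
    _ ≤ _ := Finset.sum_le_sum_of_subset_of_nonneg (Finset.subset_univ _)
          fun i _ _ => Finset.sum_nonneg fun k _ => hn i k

lemma edgeEnergy_insert {V : Type*} [DecidableEq V] {G : Digraph V} (hG : Undirected G)
    (x : V → ℝ) {S : Finset V} {u w : V} (hu : u ∉ S) (hw : w ∈ S) (huw : G.Adj u w) :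
    (x u - x w) ^ 2 + edgeEnergy G x S ≤ edgeEnergy G x (insert u S) := by
  have hn : ∀ i k, 0 ≤ adjacency G i k * (x i - x k) ^ 2 := fun i k =>
    mul_nonneg (adjacency_nonneg _ _ _) (sq_nonneg _)
  have h1 : (x u - x w) ^ 2 ≤ ∑ k ∈ S, adjacency G u k * (x u - x k) ^ 2 := by
    refine le_trans ?_ (Finset.single_le_sum (fun k _ => hn u k) hw)
    rw [adjacency_of_adj (hG _ _ huw), one_mul]
  have h2 : (x u - x w) ^ 2 ≤ ∑ k ∈ S, adjacency G k u * (x k - x u) ^ 2 := by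
    refine le_trans ?_ (Finset.single_le_sum (fun k _ => hn k u) hw)
    rw [adjacency_of_adj huw, one_mul]; exact le_of_eq (by ring)
  unfold edgeEnergy
  rw [Finset.sum_insert hu, Finset.sum_insert hu]
  simp_rw [Finset.sum_insert hu]
  rw [Finset.sum_add_distrib]
  have := hn u u
  linarith

lemma dotProduct_leaderFollowerMatrix_mulVec {N : ℕ} {G : Digraph (Fin (N + 1))} (h : Loopless G)
    (hG : Undirected (followerGraph G)) (x : Fin N → ℝ) :
    x ⬝ᵥ (leaderFollowerMatrix G *ᵥ x) =
      edgeEnergy (followerGraph G) x Finset.univ + ∑ i, adjacency G i.succ 0 * x i ^ 2 := by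
  set a := adjacency (followerGraph G)
  have h1 : ∑ i, ∑ k, a i k * (x i * (x i - x k)) = ∑ i, ∑ k, a i k * (x k * (x k - x i)) := by
    rw [Finset.sum_comm]
    refine Finset.sum_congr rfl fun i _ => Finset.sum_congr rfl fun k _ => ?_
    simp only [a]; rw [hG.adjacency_comm]
  have h2 : ∑ i, ∑ k, a i k * (x i - x k) ^ 2 = 2 * ∑ i, ∑ k, a i k * (x i * (x i - x k)) := by
    rw [two_mul]
    nth_rewrite 2 [h1]
    simp_rw [← Finset.sum_add_distrib]
    exact Finset.sum_congr rfl fun i _ => Finset.sum_congr rfl fun k _ => by ring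
  simp only [dotProduct, leaderFollowerMatrix_mulVec h, edgeEnergy]
  change _ = (∑ i, ∑ k, a i k * (x i - x k) ^ 2) / 2 + _
  rw [h2, mul_div_cancel_left₀ _ two_ne_zero, ← Finset.sum_add_distrib]
  refine Finset.sum_congr rfl fun i _ => ?_
  rw [mul_add, Finset.mul_sum]
  congr 1
  · exact Finset.sum_congr rfl fun k _ => by simp only [a]; ring
  · ring

lemma isSymm_leaderFollowerMatrix {N : ℕ} {G : Digraph (Fin (N + 1))}
    (hG : Undirected (followerGraph G)) : (leaderFollowerMatrix G)ᵀ = leaderFollowerMatrix G := by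
  rw [leaderFollowerMatrix, Matrix.transpose_add, Matrix.diagonal_transpose]
  congr 1
  ext i k
  simp only [laplacian, Matrix.transpose_apply, Matrix.of_apply]
  by_cases hik : i = k
  · subst hik; rfl
  · rw [if_neg hik, if_neg (Ne.symm hik), hG.adjacency_comm]

lemma leaderFollowerMatrix_quadratic_nonneg {N : ℕ} {G : Digraph (Fin (N + 1))} (h : Loopless G)
    (hG : Undirected (followerGraph G)) (x : Fin N → ℝ) :
    0 ≤ x ⬝ᵥ (leaderFollowerMatrix G *ᵥ x) := by
  rw [dotProduct_leaderFollowerMatrix_mulVec h hG]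
  exact add_nonneg (edgeEnergy_nonneg _ _ _) (Finset.sum_nonneg fun _ _ =>
    mul_nonneg (adjacency_nonneg _ _ _) (sq_nonneg _))

/-- A vector in the kernel, extended by `0` at the leader, is constant along the edges into the
followers. -/
lemma eq_of_leaderFollowerMatrix_mulVec_eq_zero {N : ℕ} {G : Digraph (Fin (N + 1))}
    (h : Loopless G) (hG : Undirected (followerGraph G)) {x : Fin N → ℝ}
    (hx : leaderFollowerMatrix G *ᵥ x = 0) {a : Fin (N + 1)} {i : Fin N} (hadj : G.Adj a i.succ) :
    (Fin.cons 0 x : Fin (N + 1) → ℝ) a = x i := by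
  have hn : ∀ i k, 0 ≤ adjacency (followerGraph G) i k * (x i - x k) ^ 2 := fun i k =>
    mul_nonneg (adjacency_nonneg _ _ _) (sq_nonneg _)
  have hn' : ∀ i : Fin N, 0 ≤ adjacency G i.succ 0 * x i ^ 2 := fun i =>
    mul_nonneg (adjacency_nonneg _ _ _) (sq_nonneg _)
  have h0 := dotProduct_leaderFollowerMatrix_mulVec h hG x
  rw [hx, dotProduct_zero] at h0
  have h1 := edgeEnergy_nonneg (followerGraph G) x Finset.univ
  have h2 : 0 ≤ ∑ i : Fin N, adjacency G i.succ 0 * x i ^ 2 := Finset.sum_nonneg fun i _ => hn' i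
  refine Fin.cases (fun hadj => ?_) (fun k hadj => ?_) a hadj
  · have h3 : adjacency G i.succ 0 * x i ^ 2 ≤ 0 :=
      (Finset.single_le_sum (fun i _ => hn' i) (Finset.mem_univ i)).trans (by linarith)
    rw [adjacency_of_adj hadj, one_mul] at h3
    simpa using (pow_eq_zero_iff two_ne_zero).1 (le_antisymm h3 (sq_nonneg _)) |>.symm
  · have h3 : adjacency (followerGraph G) i k * (x i - x k) ^ 2 ≤ 0 := by
      refine (Finset.single_le_sum (fun k _ => hn i k) (Finset.mem_univ k)).trans ?_
      refine (Finset.single_le_sum (f := fun i => ∑ k, adjacency (followerGraph G) i k *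
        (x i - x k) ^ 2) (fun i _ => Finset.sum_nonneg fun k _ => hn i k)
        (Finset.mem_univ i)).trans ?_
      unfold edgeEnergy at h0 h1
      linarith
    rw [adjacency_followerGraph, adjacency_of_adj hadj, one_mul] at h3
    have := (pow_eq_zero_iff two_ne_zero).1 (le_antisymm h3 (sq_nonneg _))
    simp only [Fin.cons_succ]; linarith

/-- The undirected simple graph underlying a loopless undirected digraph. -/
def toSimpleGraph {V : Type*} (G : Digraph V) (h : Loopless G) (hG : Undirected G) :
    SimpleGraph V where
  Adj := G.Adj
  symm := ⟨fun i k => hG i k⟩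
  loopless := ⟨h⟩

lemma add_sq_le_of_sq_le {a b A B : ℝ} (l : ℕ) (ha : a ^ 2 ≤ A) (hb : b ^ 2 ≤ l * B)
    (hB : 0 ≤ B) : (a + b) ^ 2 ≤ (l + 1 : ℕ) * (A + B) := by
  push_cast
  rcases Nat.eq_zero_or_pos l with rfl | hl
  · have : b = 0 := by
      have : b ^ 2 ≤ 0 := by simpa using hb
      exact (pow_eq_zero_iff two_ne_zero).1 (le_antisymm this (sq_nonneg _))
    subst this; norm_num; linarith
  · have hl' : (0 : ℝ) < l := by exact_mod_cast hl
    have h1 : 2 * a * b ≤ l * a ^ 2 + B := by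
      have : (l : ℝ) * (2 * a * b) ≤ l * (l * a ^ 2 + B) := by
        nlinarith [sq_nonneg (l * a - b)]
      exact le_of_mul_le_mul_left this hl'
    nlinarith

lemma sq_sub_le_length_mul_edgeEnergy {V : Type*} [DecidableEq V] {G : Digraph V}
    (h : Loopless G) (hG : Undirected G) (x : V → ℝ) {u v : V}
    (p : (toSimpleGraph G h hG).Walk u v) (hp : p.IsPath) :
    (x u - x v) ^ 2 ≤ p.length * edgeEnergy G x p.support.toFinset := by
  induction p with
  | nil => simp
  | @cons u w v huw p ih =>
    rw [SimpleGraph.Walk.cons_isPath_iff] at hp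
    have h1 := edgeEnergy_insert hG x (S := p.support.toFinset) (u := u) (w := w)
      (by simpa using hp.2) (by simp) huw
    have h2 := add_sq_le_of_sq_le p.length (le_refl ((x u - x w) ^ 2)) (ih hp.1)
      (edgeEnergy_nonneg _ _ _)
    rw [SimpleGraph.Walk.length_cons, SimpleGraph.Walk.support_cons, List.toFinset_cons]
    calc (x u - x v) ^ 2 = (x u - x w + (x w - x v)) ^ 2 := by ring
      _ ≤ _ := h2
      _ ≤ _ := by gcongr

lemma sq_sub_le_of_reachable {N : ℕ} {G : Digraph (Fin N)} (h : Loopless G) (hG : Undirected G)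
    (x : Fin N → ℝ) {u v : Fin N} (huv : (toSimpleGraph G h hG).Reachable u v) :
    ∃ l : ℕ, l + 1 ≤ N ∧ (x u - x v) ^ 2 ≤ l * edgeEnergy G x Finset.univ := by
  obtain ⟨p, hp⟩ := huv.exists_isPath
  refine ⟨p.length, by simpa using hp.length_lt, ?_⟩
  refine (sq_sub_le_length_mul_edgeEnergy h hG x p hp).trans ?_
  gcongr
  exact edgeEnergy_le_univ _ _ _

/-- The spectral gap of the leader-follower matrix: its positive eigenvalues are at
least `λ_H`. -/
theorem dotProduct_self_le_of_orthogonal_ker {N : ℕ} {G : Digraph (Fin (N + 1))} (h : Loopless G)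
    (hG : Undirected (followerGraph G)) {z : Fin N → ℝ}
    (hz : ∀ y, leaderFollowerMatrix G *ᵥ y = 0 → y ⬝ᵥ z = 0) :
    z ⬝ᵥ z ≤ 1 / lambdaH N * (z ⬝ᵥ (leaderFollowerMatrix G *ᵥ z)) := by
  classical
  set q := z ⬝ᵥ (leaderFollowerMatrix G *ᵥ z) with hq
  have hq0 : 0 ≤ q := leaderFollowerMatrix_quadratic_nonneg h hG z
  rw [dotProduct_leaderFollowerMatrix_mulVec h hG] at hq
  set D := followerGraph G
  set S := toSimpleGraph D h.followerGraph hG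
  have hE := edgeEnergy_nonneg D z Finset.univ
  have hn' : ∀ i : Fin N, 0 ≤ adjacency G i.succ 0 * z i ^ 2 := fun i =>
    mul_nonneg (adjacency_nonneg _ _ _) (sq_nonneg _)
  have hEq : edgeEnergy D z Finset.univ ≤ q := by
    rw [hq]; linarith [Finset.sum_nonneg fun i (_ : i ∈ Finset.univ) => hn' i]
  have hroot' : ∀ r : Fin N, G.Adj 0 r.succ → z r ^ 2 + edgeEnergy D z Finset.univ ≤ q := by
    intro r hr
    have := Finset.single_le_sum (fun i _ => hn' i) (Finset.mem_univ r)
    rw [adjacency_of_adj hr, one_mul] at this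
    linarith
  have hroot : ∀ r : Fin N, G.Adj 0 r.succ → z r ^ 2 ≤ q := fun r hr => by
    linarith [hroot' r hr]
  have hnoroot : ∀ v : Fin N, (∀ r, S.Reachable v r → ¬ G.Adj 0 r.succ) →
      z v ^ 2 ≤ (N - 1) * q := by
    intro v hv
    have hker : leaderFollowerMatrix G *ᵥ (fun i => if S.Reachable v i then 1 else 0) = 0 := by
      ext i
      rw [leaderFollowerMatrix_mulVec h]
      simp only [Pi.zero_apply]
      have h1 : adjacency G i.succ 0 * (if S.Reachable v i then 1 else 0) = 0 := by
        split_ifs with hi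
        · rw [adjacency_of_not_adj (hv i hi), zero_mul]
        · simp
      rw [h1, add_zero]
      refine Finset.sum_eq_zero fun k _ => ?_
      by_cases hki : D.Adj k i
      · have : S.Reachable v i ↔ S.Reachable v k :=
          ⟨fun h' => h'.trans (SimpleGraph.Adj.reachable (G := S) (hG _ _ hki)),
            fun h' => h'.trans (SimpleGraph.Adj.reachable (G := S) hki)⟩
        simp [this]
      · rw [adjacency_of_not_adj hki, zero_mul]
    have hsum := hz _ hker
    have hsum' : ∑ i, z v * (if S.Reachable v i then z i else 0) ≤ ∑ i : Fin N, 0 := by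
      rw [← Finset.mul_sum]
      have : ∑ i, (if S.Reachable v i then z i else 0) = 0 := by
        simpa [dotProduct] using hsum
      rw [this]; simp
    obtain ⟨w, hvw, hw⟩ : ∃ w, S.Reachable v w ∧ z v * z w ≤ 0 := by
      by_contra! hcon
      refine absurd hsum' (not_le.2 (Finset.sum_lt_sum (fun i _ => ?_) ⟨v, Finset.mem_univ _, ?_⟩))
      · split_ifs with hi
        · exact (hcon i hi).le
        · simp
      · simpa using hcon v (SimpleGraph.Reachable.refl v)
    obtain ⟨l, hl, hl'⟩ := sq_sub_le_of_reachable h.followerGraph hG z hvw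
    have hlN : (l : ℝ) ≤ N - 1 := by
      have : ((l + 1 : ℕ) : ℝ) ≤ N := by exact_mod_cast hl
      push_cast at this; linarith
    calc z v ^ 2 ≤ (z v - z w) ^ 2 := by nlinarith [sq_nonneg (z w)]
      _ ≤ _ := hl'
      _ ≤ (N - 1) * q := by
        have : (0 : ℝ) ≤ l := by positivity
        have : (0 : ℝ) ≤ N - 1 := by linarith
        gcongr
  have hall : ∀ v : Fin N, z v ^ 2 ≤ N * q := by
    intro v
    by_cases hv : ∀ r, S.Reachable v r → ¬ G.Adj 0 r.succ
    · linarith [hnoroot v hv]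
    · push Not at hv
      obtain ⟨r, hvr, hr⟩ := hv
      obtain ⟨l, hl, hl'⟩ := sq_sub_le_of_reachable h.followerGraph hG z hvr
      have h2 := add_sq_le_of_sq_le l (le_refl (z r ^ 2)) hl' hE
      have hlN : ((l + 1 : ℕ) : ℝ) ≤ N := by exact_mod_cast hl
      calc z v ^ 2 = (z r + (z v - z r)) ^ 2 := by ring
        _ ≤ _ := h2
        _ ≤ N * q := by
          gcongr
          exact hroot' r hr
  have hmain : z ⬝ᵥ z ≤ ((N : ℝ) * (N ^ 2 - N + 4) / 4) * q := by
    have hzz : z ⬝ᵥ z = ∑ v, z v ^ 2 := by simp [dotProduct, sq]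
    rw [hzz]
    rcases Nat.eq_zero_or_pos N with hN | hN
    · subst hN; simp
    have hN1 : (1 : ℝ) ≤ N := by exact_mod_cast hN
    by_cases hr : ∃ r : Fin N, G.Adj 0 r.succ
    · obtain ⟨r, hr⟩ := hr
      rw [← Finset.add_sum_erase _ _ (Finset.mem_univ r)]
      have h1 : ∑ v ∈ Finset.univ.erase r, z v ^ 2 ≤ (N - 1) * (N * q) := by
        refine (Finset.sum_le_card_nsmul _ _ _ fun v _ => hall v).trans_eq ?_
        rw [Finset.card_erase_of_mem (Finset.mem_univ r), nsmul_eq_mul]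
        simp [Nat.cast_sub (Nat.succ_le_of_lt hN)]
      have h2 := hroot r hr
      have h3 : 0 ≤ (((N : ℝ) - 1) * (N - 2) ^ 2) * q :=
        mul_nonneg (mul_nonneg (by linarith) (sq_nonneg _)) hq0
      nlinarith
    · push Not at hr
      have h1 : ∑ v, z v ^ 2 ≤ N * ((N - 1) * q) := by
        refine (Finset.sum_le_card_nsmul _ _ _ fun v _ => hnoroot v fun r _ => hr r).trans_eq ?_
        simp
      have h3 : 0 ≤ (((N : ℝ) - 1) * (N - 2) ^ 2) * q :=
        mul_nonneg (mul_nonneg (by linarith) (sq_nonneg _)) hq0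
      nlinarith
  rwa [lambdaH, one_div_div]

lemma IsSwitchingSignal.add_mul_le {n₀ : ℕ} {σ : ℝ → Fin n₀} {t : ℕ → ℝ} {τ : ℝ}
    (h : IsSwitchingSignal σ t τ) (a l : ℕ) : t a + l * τ ≤ t (a + l) := by
  induction l with
  | zero => simp
  | succ l ih =>
    have := h.dwell (a + l)
    rw [← add_assoc]; push_cast; linarith

lemma IsSwitchingSignal.strictMono {n₀ : ℕ} {σ : ℝ → Fin n₀} {t : ℕ → ℝ} {τ : ℝ}
    (h : IsSwitchingSignal σ t τ) : StrictMono t :=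
  strictMono_nat_of_lt_succ fun r => by linarith [h.dwell r, h.dwell_pos]

lemma IsSwitchingSignal.nonneg {n₀ : ℕ} {σ : ℝ → Fin n₀} {t : ℕ → ℝ} {τ : ℝ}
    (h : IsSwitchingSignal σ t τ) (r : ℕ) : 0 ≤ t r := by
  rw [← h.zero]; exact h.strictMono.monotone (Nat.zero_le r)

lemma JointlyConnected.length_le {N n₀ : ℕ} {G : Fin n₀ → Digraph (Fin (N + 1))} {σ : ℝ → Fin n₀}
    {t : ℕ → ℝ} {τ : ℝ} (hσ : IsSwitchingSignal σ t τ) {j : ℕ → ℕ} {Tc : ℝ}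
    (h : JointlyConnected G σ t j Tc) (k : ℕ) : j (k + 1) - j k ≤ ⌊Tc / τ⌋₊ := by
  refine Nat.le_floor ((le_div_iff₀ hσ.dwell_pos).2 ?_)
  have h1 := hσ.add_mul_le (j k) (j (k + 1) - j k)
  rw [Nat.add_sub_cancel' (h.strictMono.monotone (Nat.le_succ k))] at h1
  linarith [h.gap k]

lemma orderedProd_add {M : Type*} [Monoid M] (P : ℕ → M) (a l l' : ℕ) :
    orderedProd P a (l + l') = orderedProd P (a + l) l' * orderedProd P a l := by
  induction l' with
  | zero => simp [orderedProd]
  | succ l' ih => rw [← add_assoc, orderedProd, orderedProd, ih, mul_assoc, add_assoc]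

lemma map_orderedProd {M M' F : Type*} [Monoid M] [Monoid M'] [FunLike F M M']
    [MonoidHomClass F M M'] (f : F) (P : ℕ → M) (a l : ℕ) :
    f (orderedProd P a l) = orderedProd (fun r => f (P r)) a l := by
  induction l with
  | zero => simp [orderedProd]
  | succ l ih => simp [orderedProd, ih]

lemma finite_orderedProd {M ι : Type*} [Monoid M] [Finite ι] (P : ι → M) (R : ℕ) :
    {Q | ∃ (s : ℕ → ι) (a l : ℕ), l ≤ R ∧ Q = orderedProd (fun r => P (s r)) a l}.Finite := by
  have key : ∀ l : ℕ, {Q | ∃ (s : ℕ → ι) (a : ℕ),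
      Q = orderedProd (fun r => P (s r)) a l}.Finite := by
    intro l
    induction l with
    | zero =>
      refine (Set.finite_singleton (1 : M)).subset ?_
      rintro Q ⟨s, a, rfl⟩; rfl
    | succ l ih =>
      refine (Set.Finite.image2 (· * ·) (Set.finite_range P) ih).subset ?_
      rintro Q ⟨s, a, rfl⟩
      exact ⟨_, ⟨s (a + l), rfl⟩, _, ⟨s, a, rfl⟩, rfl⟩
  refine (Set.Finite.biUnion (Set.finite_Iic R) fun l _ => key l).subset ?_
  rintro Q ⟨s, a, l, hl, rfl⟩
  exact Set.mem_biUnion hl ⟨s, a, rfl⟩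

/-- A vector whose norm survives a product of orthogonal projections lies in all the ranges. -/
lemma mem_of_norm_le_orderedProd_starProjection {E : Type*} [NormedAddCommGroup E]
    [InnerProductSpace ℝ E] [FiniteDimensional ℝ E] (U : ℕ → Submodule ℝ E) (a l : ℕ) {x : E}
    (hx : ‖x‖ ≤ ‖orderedProd (fun r => (U r).starProjection) a l x‖) :
    (∀ i < l, x ∈ U (a + i)) ∧ orderedProd (fun r => (U r).starProjection) a l x = x := by
  induction l with
  | zero => simp [orderedProd]
  | succ l ih =>
    have h1 : ‖orderedProd (fun r => (U r).starProjection) a (l + 1) x‖ ≤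
      ‖orderedProd (fun r => (U r).starProjection) a l x‖ :=
      (U (a + l)).norm_starProjection_apply_le _
    obtain ⟨h2, h3⟩ := ih (hx.trans h1)
    have h4 : orderedProd (fun r => (U r).starProjection) a (l + 1) x =
        (U (a + l)).starProjection x := by
      change (U (a + l)).starProjection (orderedProd (fun r => (U r).starProjection) a l x) = _
      rw [h3]
    rw [h4] at hx
    have h5 : x ∈ U (a + l) := ((U (a + l)).mem_iff_norm_starProjection x).2
      (le_antisymm ((U (a + l)).norm_starProjection_apply_le _) hx)
    refine ⟨fun i hi => ?_, ?_⟩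
    · rcases Nat.lt_succ_iff_lt_or_eq.1 hi with hi | rfl
      · exact h2 i hi
      · exact h5
    · rw [h4]; exact Submodule.starProjection_eq_self_iff.2 h5

lemma opNorm_lt_one_of_forall_lt {E : Type*} [NormedAddCommGroup E] [NormedSpace ℝ E]
    [FiniteDimensional ℝ E] (Q : E →L[ℝ] E) (h : ∀ x, x ≠ 0 → ‖Q x‖ < ‖x‖) : ‖Q‖ < 1 := by
  rcases subsingleton_or_nontrivial E with hE | hE
  · have : Q = 0 := by ext x; exact Subsingleton.elim _ _
    rw [this]; simp
  · obtain ⟨x, hx, hmax⟩ := (isCompact_sphere (0 : E) 1).exists_isMaxOn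
      (NormedSpace.sphere_nonempty.2 zero_le_one) (Q.continuous.norm.continuousOn)
    have hx1 : ‖x‖ = 1 := by simpa using hx
    have hx0 : x ≠ 0 := by rintro rfl; simp at hx1
    refine lt_of_le_of_lt ?_ (hx1 ▸ h x hx0)
    refine Q.opNorm_le_of_unit_norm (norm_nonneg _) fun y hy => ?_
    exact hmax (by simpa using hy)

section
variable {N n₀ : ℕ} {G : Fin n₀ → Digraph (Fin (N + 1))} {σ : ℝ → Fin n₀} {t : ℕ → ℝ} {τ : ℝ}
  {j : ℕ → ℕ} {Tc : ℝ}

lemma eq_zero_of_mem_ker_of_reachable (hG : ∀ p, Loopless (G p)) (hσ : IsSwitchingSignal σ t τ)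
    (hund : ∀ s, 0 ≤ s → Undirected (followerGraph (G (σ s))))
    (hconn : JointlyConnected G σ t j Tc) (k : ℕ) {x : EuclideanSpace ℝ (Fin N)}
    (hx : ∀ i < j (k + 1) - j k,
      x ∈ LinearMap.ker (Matrix.toEuclideanLin (leaderFollowerMatrix (G (σ (t (j k + i))))))) :
    x = 0 := by
  have hx' : ∀ r, t r ∈ Ico (t (j k)) (t (j (k + 1))) →
      leaderFollowerMatrix (G (σ (t r))) *ᵥ x.ofLp = 0 := by
    rintro r ⟨h1, h2⟩
    have h1' := hσ.strictMono.le_iff_le.1 h1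
    have h2' := hσ.strictMono.lt_iff_lt.1 h2
    have := hx (r - j k) (by omega)
    rw [Nat.add_sub_cancel' h1', LinearMap.mem_ker] at this
    simpa [Matrix.toLpLin_apply] using congrArg WithLp.ofLp this
  have key : ∀ a,
      Reachable (⨆ r : {r : ℕ // t r ∈ Ico (t (j k)) (t (j (k + 1)))}, G (σ (t r))) 0 a →
      (Fin.cons 0 x.ofLp : Fin (N + 1) → ℝ) a = 0 := by
    intro a ha
    induction ha with
    | refl => simp
    | @tail b c _ hbc ih =>
      obtain ⟨⟨r, hr⟩, hbc⟩ := Digraph.iSup_adj.1 hbc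
      refine Fin.cases (by simp) (fun i hbc => ?_) c hbc
      rw [Fin.cons_succ, ← ih]
      exact (eq_of_leaderFollowerMatrix_mulVec_eq_zero (hG _) (hund _ (hσ.nonneg r)) (hx' r hr)
        hbc).symm
  ext i
  simpa using key i.succ (hconn.reachable k i)

theorem exists_isContractionFactor (hG : ∀ p, Loopless (G p)) (hσ : IsSwitchingSignal σ t τ)
    (hund : ∀ s, 0 ≤ s → Undirected (followerGraph (G (σ s))))
    (hconn : JointlyConnected G σ t j Tc) : ∃ δ, IsContractionFactor G σ t j δ := by
  set Q : ℕ → EuclideanSpace ℝ (Fin N) →L[ℝ] EuclideanSpace ℝ (Fin N) := fun k =>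
    orderedProd (fun r => kerProjection (G (σ (t r)))) (j k) (j (k + 1) - j k) with hQ
  have hlt : ∀ k, ‖Q k‖ < 1 := fun k => by
    refine opNorm_lt_one_of_forall_lt _ fun x hx => ?_
    by_contra! hcon
    exact hx (eq_zero_of_mem_ker_of_reachable hG hσ hund hconn k
      (mem_of_norm_le_orderedProd_starProjection (fun r => LinearMap.ker
        (Matrix.toEuclideanLin (leaderFollowerMatrix (G (σ (t r)))))) _ _ hcon).1)
  have hfin : (Set.range fun k => ‖Q k‖).Finite := by
    refine ((finite_orderedProd (fun p => kerProjection (G p)) ⌊Tc / τ⌋₊).image norm).subset ?_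
    rintro _ ⟨k, rfl⟩
    exact ⟨Q k, ⟨fun r => σ (t r), j k, _, hconn.length_le hσ k, rfl⟩, rfl⟩
  obtain ⟨c, hc, hmax⟩ := Set.exists_max_image _ id hfin ⟨_, 0, rfl⟩
  obtain ⟨k₀, rfl⟩ := hc
  refine ⟨max ‖Q k₀‖ 2⁻¹, by positivity, max_lt (hlt k₀) (by norm_num), fun k => ?_⟩
  exact (hmax _ ⟨k, rfl⟩).trans (le_max_left _ _)

end

attribute [local instance] Matrix.frobeniusNormedAddCommGroup Matrix.frobeniusNormedSpace
  Matrix.frobeniusNormedRing Matrix.frobeniusNormedAlgebra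

section calculus

lemma hasDerivWithinAt_matrix_iff {m n : ℕ} {f : ℝ → Matrix (Fin m) (Fin n) ℝ}
    {f' : Matrix (Fin m) (Fin n) ℝ} {s : Set ℝ} {x : ℝ} :
    HasDerivWithinAt f f' s x ↔ ∀ i k, HasDerivWithinAt (fun x => f x i k) (f' i k) s x :=
  ⟨fun h i k => hasDerivWithinAt_pi.1 (hasDerivWithinAt_pi.1 h i) k,
    fun h => hasDerivWithinAt_pi.2 fun i => hasDerivWithinAt_pi.2 (h i)⟩

lemma _root_.HasDerivWithinAt.matrixMul {l m n : ℕ} {f : ℝ → Matrix (Fin l) (Fin m) ℝ}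
    {g : ℝ → Matrix (Fin m) (Fin n) ℝ} {f' : Matrix (Fin l) (Fin m) ℝ}
    {g' : Matrix (Fin m) (Fin n) ℝ} {s : Set ℝ} {x : ℝ} (hf : HasDerivWithinAt f f' s x)
    (hg : HasDerivWithinAt g g' s x) :
    HasDerivWithinAt (fun x => f x * g x) (f' * g x + f x * g') s x := by
  rw [hasDerivWithinAt_matrix_iff] at *
  intro i k
  have := HasDerivWithinAt.fun_sum (u := Finset.univ) fun (q : Fin m) _ => (hf i q).mul (hg q k)
  refine (this.congr_deriv ?_).congr_of_eventuallyEq (Eventually.of_forall fun y => ?_) ?_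
  · simp only [Matrix.mul_apply, Matrix.add_apply, Finset.sum_add_distrib]
  · simp [Matrix.mul_apply]
  · simp [Matrix.mul_apply]

lemma _root_.HasDerivAt.matrixMul {l m n : ℕ} {f : ℝ → Matrix (Fin l) (Fin m) ℝ}
    {g : ℝ → Matrix (Fin m) (Fin n) ℝ} {f' : Matrix (Fin l) (Fin m) ℝ}
    {g' : Matrix (Fin m) (Fin n) ℝ} {x : ℝ} (hf : HasDerivAt f f' x)
    (hg : HasDerivAt g g' x) :
    HasDerivAt (fun x => f x * g x) (f' * g x + f x * g') x := by
  exact hasDerivWithinAt_univ.1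
    ((hasDerivWithinAt_univ.2 hf).matrixMul (hasDerivWithinAt_univ.2 hg))

lemma _root_.ContinuousOn.matrixMul {l m n : ℕ} {f : ℝ → Matrix (Fin l) (Fin m) ℝ}
    {g : ℝ → Matrix (Fin m) (Fin n) ℝ} {s : Set ℝ} (hf : ContinuousOn f s)
    (hg : ContinuousOn g s) : ContinuousOn (fun x => f x * g x) s :=
  continuousOn_iff_continuous_domRestrict.2 ((continuousOn_iff_continuous_domRestrict.1 hf).matrix_mul
    (continuousOn_iff_continuous_domRestrict.1 hg))

lemma hasDerivAt_exp_smul {n : ℕ} (B : Matrix (Fin n) (Fin n) ℝ) (s : ℝ) :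
    HasDerivAt (fun s : ℝ => exp (s • B)) (exp (s • B) * B) s := hasDerivAt_exp_smul_const B s

lemma hasDerivAt_exp_smul' {n : ℕ} (B : Matrix (Fin n) (Fin n) ℝ) (s : ℝ) :
    HasDerivAt (fun s : ℝ => exp (s • B)) (B * exp (s • B)) s := hasDerivAt_exp_smul_const' B s

lemma exp_add_smul {n : ℕ} (B : Matrix (Fin n) (Fin n) ℝ) (s s' : ℝ) :
    exp ((s + s') • B) = exp (s • B) * exp (s' • B) := by
  rw [add_smul]
  exact Matrix.exp_add_of_commute _ _ ((Commute.refl B).smul_left s |>.smul_right s')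

/-- A solution of `X' = X B`, with right derivatives, on an interval. -/
lemma eq_mul_exp_of_hasDerivWithinAt {l n : ℕ} {B : Matrix (Fin n) (Fin n) ℝ}
    {X : ℝ → Matrix (Fin l) (Fin n) ℝ} {a b : ℝ} (hc : ContinuousOn X (Icc a b))
    (hX : ∀ s ∈ Ico a b, HasDerivWithinAt X (X s * B) (Ici s) s) {s : ℝ} (hs : s ∈ Icc a b) :
    X s = X a * exp ((s - a) • B) := by
  have hE : ∀ s : ℝ, HasDerivAt (fun s : ℝ => exp ((s - a) • (-B)))
      ((-B) * exp ((s - a) • (-B))) s := fun s => by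
    refine ((hasDerivAt_exp_smul' (-B) (s - a)).scomp s
      ((hasDerivAt_id s).sub_const a)).congr_deriv (one_smul ℝ _)
  have h1 := constant_of_has_deriv_right_zero (f := fun s => X s * exp ((s - a) • (-B)))
    (a := a) (b := b) (ContinuousOn.matrixMul hc fun s _ => (hE s).continuousAt.continuousWithinAt)
    (fun s hs => by
      refine ((hX s hs).matrixMul (hE s).hasDerivWithinAt).congr_deriv ?_
      simp [Matrix.mul_assoc]) s hs
  simp only [sub_self, zero_smul, NormedSpace.exp_zero] at h1
  have h2 : exp ((s - a) • (-B)) * exp ((s - a) • B) = 1 := by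
    rw [smul_neg, ← neg_smul, ← exp_add_smul]; simp
  rw [show X a = X s * exp ((s - a) • (-B)) by simpa using h1.symm, Matrix.mul_assoc, h2,
    Matrix.mul_one]

end calculus

section gramian
variable {n m : ℕ} (A : Matrix (Fin n) (Fin n) ℝ) (C : Matrix (Fin m) (Fin n) ℝ)

/-- The integrand of the weighted Gramian. -/
def gramianIntegrand (α s : ℝ) : Matrix (Fin n) (Fin n) ℝ :=
  Real.exp (-α * s) • (exp (-(s / 2) • A.transpose) * C.transpose * C * exp (-(s / 2) • A))

lemma gramianIntegrand_eq (α s : ℝ) : gramianIntegrand A C α s =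
    Real.exp (-α * s) • (exp (s • (-(1 / 2 : ℝ) • Aᵀ)) * (Cᵀ * C) * exp (s • (-(1 / 2 : ℝ) • A))) := by
  have : -(s / 2) = s * (-(1 / 2)) := by ring
  rw [gramianIntegrand, this, mul_smul, mul_smul, Matrix.mul_assoc _ Cᵀ C]

lemma hasDerivAt_gramianIntegrand (α s : ℝ) : HasDerivAt (gramianIntegrand A C α)
    (-α • gramianIntegrand A C α s -
      (1 / 2 : ℝ) • (Aᵀ * gramianIntegrand A C α s + gramianIntegrand A C α s * A)) s := by
  have h1 : HasDerivAt (fun s : ℝ => Real.exp (-α * s)) (Real.exp (-α * s) * (-α)) s := by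
    simpa using ((hasDerivAt_id s).const_mul (-α)).exp
  have h2 := ((hasDerivAt_exp_smul' (-(1 / 2 : ℝ) • Aᵀ) s).matrixMul
    (hasDerivAt_const s (Cᵀ * C))).matrixMul (hasDerivAt_exp_smul (-(1 / 2 : ℝ) • A) s)
  have h3 := h1.smul h2
  have h4 : gramianIntegrand A C α = fun s => Real.exp (-α * s) •
    (exp (s • (-(1 / 2 : ℝ) • Aᵀ)) * (Cᵀ * C) * exp (s • (-(1 / 2 : ℝ) • A))) :=
    funext fun s => gramianIntegrand_eq A C α s
  rw [h4]
  refine h3.congr_deriv ?_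
  simp only [Matrix.mul_assoc, Matrix.mul_zero, add_zero, Matrix.smul_mul, Matrix.mul_smul,
    smul_add, smul_smul]
  module

lemma continuous_gramianIntegrand (α : ℝ) : Continuous (gramianIntegrand A C α) :=
  continuous_iff_continuousAt.2 fun s => (hasDerivAt_gramianIntegrand A C α s).continuousAt

lemma dotProduct_gramianIntegrand_mulVec (α s : ℝ) (x : Fin n → ℝ) :
    x ⬝ᵥ (gramianIntegrand A C α s *ᵥ x) = Real.exp (-α * s) *
      ((C *ᵥ (exp (-(s / 2) • A) *ᵥ x)) ⬝ᵥ (C *ᵥ (exp (-(s / 2) • A) *ᵥ x))) := by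
  rw [gramianIntegrand, ← Matrix.transpose_smul, Matrix.exp_transpose, Matrix.smul_mulVec,
    dotProduct_smul, smul_eq_mul]
  congr 1
  rw [Matrix.mulVec_mulVec, Matrix.mul_assoc, ← Matrix.transpose_mul, ← Matrix.mulVec_mulVec,
    Matrix.mulVec_transpose, dotProduct_comm, ← Matrix.dotProduct_mulVec]

lemma dotProduct_gramianIntegrand_mulVec_nonneg (α s : ℝ) (x : Fin n → ℝ) :
    0 ≤ x ⬝ᵥ (gramianIntegrand A C α s *ᵥ x) := by
  rw [dotProduct_gramianIntegrand_mulVec]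
  exact mul_nonneg (Real.exp_pos _).le (Finset.sum_nonneg fun i _ => mul_self_nonneg _)

lemma weightedGramian_apply (α T : ℝ) (i k : Fin n) :
    weightedGramian A C α T i k = ∫ s in (0 : ℝ)..T, gramianIntegrand A C α s i k := rfl

lemma intervalIntegrable_gramianIntegrand (α a b : ℝ) (i k : Fin n) :
    IntervalIntegrable (fun s => gramianIntegrand A C α s i k) MeasureTheory.volume a b :=
  ((continuous_gramianIntegrand A C α).matrix_elem i k).intervalIntegrable _ _

lemma dotProduct_weightedGramian_mulVec (α T : ℝ) (x : Fin n → ℝ) :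
    x ⬝ᵥ (weightedGramian A C α T *ᵥ x) =
      ∫ s in (0 : ℝ)..T, x ⬝ᵥ (gramianIntegrand A C α s *ᵥ x) := by
  simp only [dotProduct, Matrix.mulVec, weightedGramian_apply, Finset.mul_sum]
  rw [intervalIntegral.integral_finsetSum fun i _ => ?_]
  · refine Finset.sum_congr rfl fun i _ => ?_
    rw [intervalIntegral.integral_finsetSum fun k _ => ?_]
    · refine Finset.sum_congr rfl fun k _ => ?_
      rw [intervalIntegral.integral_const_mul, intervalIntegral.integral_mul_const]
    · exact ((intervalIntegrable_gramianIntegrand A C α 0 T i k).mul_const _).const_mul _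
  · refine Continuous.intervalIntegrable ?_ _ _
    have := continuous_gramianIntegrand A C α
    fun_prop

/-- The Lyapunov equation of the weighted Gramian. -/
lemma weightedGramian_lyapunov (α T : ℝ) :
    Aᵀ * weightedGramian A C α T + weightedGramian A C α T * A =
      (-(2 * α)) • weightedGramian A C α T + (2 : ℝ) • (Cᵀ * C) -
        (2 : ℝ) • gramianIntegrand A C α T := by
  have h0 : gramianIntegrand A C α 0 = Cᵀ * C := by simp [gramianIntegrand_eq]
  ext i k
  have hI := fun i k => intervalIntegrable_gramianIntegrand A C α 0 T i k
  have hint : IntervalIntegrable (fun s => (-α • gramianIntegrand A C α s -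
      (1 / 2 : ℝ) • (Aᵀ * gramianIntegrand A C α s + gramianIntegrand A C α s * A)) i k)
      MeasureTheory.volume 0 T := by
    refine Continuous.intervalIntegrable ?_ _ _
    have := continuous_gramianIntegrand A C α
    refine Continuous.matrix_elem ?_ i k
    fun_prop
  have hL : (Aᵀ * weightedGramian A C α T) i k =
      ∫ s in (0 : ℝ)..T, (Aᵀ * gramianIntegrand A C α s) i k := by
    simp only [Matrix.mul_apply, weightedGramian_apply]
    rw [intervalIntegral.integral_finsetSum fun q _ => (hI q k).const_mul _]
    simp only [intervalIntegral.integral_const_mul]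
  have hR : (weightedGramian A C α T * A) i k =
      ∫ s in (0 : ℝ)..T, (gramianIntegrand A C α s * A) i k := by
    simp only [Matrix.mul_apply, weightedGramian_apply]
    rw [intervalIntegral.integral_finsetSum fun q _ => (hI i q).mul_const _]
    simp only [intervalIntegral.integral_mul_const]
  have hcL : IntervalIntegrable (fun s => (Aᵀ * gramianIntegrand A C α s) i k)
      MeasureTheory.volume 0 T :=
    ((continuous_const.matrix_mul (continuous_gramianIntegrand A C α)).matrix_elem
      i k).intervalIntegrable _ _
  have hcR : IntervalIntegrable (fun s => (gramianIntegrand A C α s * A) i k)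
      MeasureTheory.volume 0 T :=
    (((continuous_gramianIntegrand A C α).matrix_mul continuous_const).matrix_elem
      i k).intervalIntegrable _ _
  have hftc := intervalIntegral.integral_eq_sub_of_hasDerivAt (a := 0) (b := T)
    (f := fun s => gramianIntegrand A C α s i k)
    (f' := fun s => (-α • gramianIntegrand A C α s -
      (1 / 2 : ℝ) • (Aᵀ * gramianIntegrand A C α s + gramianIntegrand A C α s * A)) i k)
    (fun s _ => by
      exact hasDerivWithinAt_univ.1 (hasDerivWithinAt_matrix_iff.1 (hasDerivWithinAt_univ.2
        (hasDerivAt_gramianIntegrand A C α s)) i k)) hint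
  simp only [Matrix.sub_apply, Matrix.smul_apply, Matrix.add_apply, smul_eq_mul] at hftc ⊢
  rw [intervalIntegral.integral_sub ((hI i k).const_mul _) ((hcL.add hcR).const_mul _),
    intervalIntegral.integral_const_mul, intervalIntegral.integral_const_mul,
    intervalIntegral.integral_add hcL hcR, ← hL, ← hR, ← weightedGramian_apply, h0] at hftc
  linarith

lemma transpose_gramianIntegrand (α s : ℝ) :
    (gramianIntegrand A C α s)ᵀ = gramianIntegrand A C α s := by
  simp only [gramianIntegrand, Matrix.transpose_smul, Matrix.transpose_mul, ← Matrix.exp_transpose,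
    Matrix.transpose_transpose, Matrix.mul_assoc]

lemma transpose_weightedGramian (α T : ℝ) :
    (weightedGramian A C α T)ᵀ = weightedGramian A C α T := by
  ext i k
  rw [Matrix.transpose_apply, weightedGramian_apply, weightedGramian_apply]
  congr 1 with s
  rw [← Matrix.transpose_apply (gramianIntegrand A C α s), transpose_gramianIntegrand]

variable {A C}

/-- The output of `x' = -A x / 2` does not vanish identically on an interval, unless `x = 0`. -/
lemma Observable.exists_output_ne_zero (hobs : Observable C A) {x : Fin n → ℝ} (hx : x ≠ 0)
    {T : ℝ} (hT : 0 < T) : ∃ s ∈ Icc 0 T, C *ᵥ (exp (-(s / 2) • A) *ᵥ x) ≠ 0 := by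
  by_contra! hcon
  refine hx (hobs x 0 fun s _ => ?_)
  ext i
  let Λ : Matrix (Fin n) (Fin n) ℝ →ₗ[ℝ] ℝ :=
    { toFun := fun M => (C *ᵥ (M *ᵥ x)) i
      map_add' := fun M M' => by simp [Matrix.add_mulVec, Matrix.mulVec_add]
      map_smul' := fun c M => by simp [Matrix.smul_mulVec, Matrix.mulVec_smul] }
  let Λc : Matrix (Fin n) (Fin n) ℝ →L[ℝ] ℝ := LinearMap.toContinuousLinearMap Λ
  have hf : AnalyticOnNhd ℝ (fun s : ℝ => Λc (exp (s • A))) univ := fun s _ => by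
    have h1 : AnalyticAt ℝ (fun s : ℝ => s • A) s := analyticAt_id.smul analyticAt_const
    have h2 : AnalyticAt ℝ (fun s : ℝ => exp (s • A)) s :=
      (NormedSpace.exp_analytic (𝕂 := ℝ) (s • A)).comp (f := fun s : ℝ => s • A) h1
    exact (Λc.analyticAt _).comp h2
  have hg : AnalyticOnNhd ℝ (fun _ : ℝ => (0 : ℝ)) univ := analyticOnNhd_const
  have hev : (fun s : ℝ => Λc (exp (s • A))) =ᶠ[𝓝 (-(T / 4))] fun _ => 0 := by
    filter_upwards [Ioo_mem_nhds (show -(T / 2) < -(T / 4) by linarith)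
      (show -(T / 4) < 0 by linarith)] with s hs
    have := hcon (-2 * s) ⟨by linarith [hs.2], by linarith [hs.1]⟩
    rw [show -(-2 * s / 2) = s by ring] at this
    exact congrFun this i
  have := congrFun (hf.eq_of_eventuallyEq hg hev) s
  simpa [Λc, Λ] using this

theorem posDef_weightedGramian (hobs : Observable C A) (α : ℝ) {T : ℝ} (hT : 0 < T) :
    (weightedGramian A C α T).PosDef := by
  refine Matrix.PosDef.of_dotProduct_mulVec_pos ?_ fun x hx => ?_
  · rw [Matrix.IsHermitian, Matrix.conjTranspose_eq_transpose_of_trivial, transpose_weightedGramian]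
  rw [star_trivial, dotProduct_weightedGramian_mulVec]
  refine intervalIntegral.integral_pos hT ?_
    (fun s _ => dotProduct_gramianIntegrand_mulVec_nonneg A C α s x) ?_
  · have := continuous_gramianIntegrand A C α
    exact Continuous.continuousOn (by fun_prop)
  · obtain ⟨s, hs, hne⟩ := hobs.exists_output_ne_zero hx hT
    refine ⟨s, hs, ?_⟩
    rw [dotProduct_gramianIntegrand_mulVec]
    have : 0 < (C *ᵥ (exp (-(s / 2) • A) *ᵥ x)) ⬝ᵥ (C *ᵥ (exp (-(s / 2) • A) *ᵥ x)) := by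
      simpa using Matrix.dotProduct_star_self_pos_iff.2 hne
    positivity

lemma dotProduct_weightedGramian_mulVec_le {α T : ℝ} (hα : 0 ≤ α) (hT : 0 ≤ T) (x : Fin n → ℝ) :
    x ⬝ᵥ (weightedGramian A C α T *ᵥ x) ≤ x ⬝ᵥ (weightedGramian A C 0 T *ᵥ x) := by
  simp only [dotProduct_weightedGramian_mulVec]
  have h1 := continuous_gramianIntegrand A C α
  have h2 := continuous_gramianIntegrand A C 0
  refine intervalIntegral.integral_mono_on hT
    (Continuous.intervalIntegrable (by fun_prop) _ _)
    (Continuous.intervalIntegrable (by fun_prop) _ _) fun s hs => ?_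
  simp only [dotProduct_gramianIntegrand_mulVec]
  refine mul_le_mul_of_nonneg_right (Real.exp_le_exp.2 ?_)
    (Finset.sum_nonneg fun i _ => mul_self_nonneg _)
  have := mul_nonneg hα hs.1
  linarith

lemma exp_mul_le_dotProduct_weightedGramian_mulVec {α h T : ℝ} (hα : 0 ≤ α) (hh : 0 ≤ h)
    (hT : h ≤ T) (x : Fin n → ℝ) :
    Real.exp (-α * h) * (x ⬝ᵥ (weightedGramian A C 0 h *ᵥ x)) ≤
      x ⬝ᵥ (weightedGramian A C α T *ᵥ x) := by
  simp only [dotProduct_weightedGramian_mulVec]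
  have h1 := continuous_gramianIntegrand A C α
  have h2 := continuous_gramianIntegrand A C 0
  have hI : ∀ a b, IntervalIntegrable (fun s => x ⬝ᵥ (gramianIntegrand A C α s *ᵥ x))
    MeasureTheory.volume a b := fun a b => Continuous.intervalIntegrable (by fun_prop) _ _
  rw [← intervalIntegral.integral_add_adjacent_intervals (hI 0 h) (hI h T),
    ← intervalIntegral.integral_const_mul]
  have h3 : 0 ≤ ∫ s in h..T, x ⬝ᵥ (gramianIntegrand A C α s *ᵥ x) :=
    intervalIntegral.integral_nonneg hT fun s _ =>
      dotProduct_gramianIntegrand_mulVec_nonneg A C α s x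
  refine le_trans ?_ (le_add_of_nonneg_right h3)
  refine intervalIntegral.integral_mono_on hh
    (Continuous.intervalIntegrable (by fun_prop) _ _) (hI _ _) fun s hs => ?_
  simp only [dotProduct_gramianIntegrand_mulVec]
  rw [neg_zero, zero_mul, Real.exp_zero, one_mul]
  refine mul_le_mul_of_nonneg_right (Real.exp_le_exp.2 ?_)
    (Finset.sum_nonneg fun i _ => mul_self_nonneg _)
  have := mul_le_mul_of_nonneg_left hs.2 hα
  linarith

end gramian

lemma exists_mul_le_dotProduct_mulVec {n : ℕ} {W : Matrix (Fin n) (Fin n) ℝ} (hW : W.PosDef) :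
    ∃ c > 0, ∀ x : Fin n → ℝ, c * (x ⬝ᵥ x) ≤ x ⬝ᵥ (W *ᵥ x) := by
  rcases isEmpty_or_nonempty (Fin n) with hn | hn
  · exact ⟨1, one_pos, fun x => by simp [dotProduct]⟩
  have hc : Continuous fun x : EuclideanSpace ℝ (Fin n) => x.ofLp ⬝ᵥ (W *ᵥ x.ofLp) := by fun_prop
  obtain ⟨x, hx, hmin⟩ := (isCompact_sphere (0 : EuclideanSpace ℝ (Fin n)) 1).exists_isMinOn
      (NormedSpace.sphere_nonempty.2 zero_le_one) hc.continuousOn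
  have hx1 : ‖x‖ = 1 := by simpa using hx
  have hx0 : x.ofLp ≠ 0 := fun h => by
    have : x = 0 := by ext i; exact congrFun h i
    simp [this] at hx1
  refine ⟨x.ofLp ⬝ᵥ (W *ᵥ x.ofLp), by simpa using hW.dotProduct_mulVec_pos hx0, fun y => ?_⟩
  set z : EuclideanSpace ℝ (Fin n) := WithLp.toLp 2 y
  have hz : y ⬝ᵥ y = ‖z‖ ^ 2 := by
    rw [EuclideanSpace.norm_sq_eq]; simp [dotProduct, sq, z]
  rcases eq_or_ne z 0 with h0 | h0
  · have : y = 0 := congrArg WithLp.ofLp h0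
    simp [this]
  have hz0 : 0 < ‖z‖ := norm_pos_iff.2 h0
  have h1 : ‖z‖⁻¹ • z ∈ Metric.sphere (0 : EuclideanSpace ℝ (Fin n)) 1 := by
    simp [norm_smul, hz0.ne']
  have h2 := hmin h1
  simp only [mem_ofPred_eq, WithLp.ofLp_smul, Matrix.mulVec_smul, dotProduct_smul, smul_dotProduct,
    smul_eq_mul] at h2
  rw [hz]
  have h3 : ‖z‖ ^ 2 * (‖z‖⁻¹ * (‖z‖⁻¹ * (z.ofLp ⬝ᵥ W *ᵥ z.ofLp))) = z.ofLp ⬝ᵥ W *ᵥ z.ofLp := by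
    field_simp
  calc _ = ‖z‖ ^ 2 * (x.ofLp ⬝ᵥ W *ᵥ x.ofLp) := mul_comm _ _
    _ ≤ ‖z‖ ^ 2 * (‖z‖⁻¹ * (‖z‖⁻¹ * (z.ofLp ⬝ᵥ W *ᵥ z.ofLp))) := by gcongr
    _ = _ := h3

lemma frobenius_norm_sq {m n : ℕ} {𝕜 : Type*} [RCLike 𝕜] (M : Matrix (Fin m) (Fin n) 𝕜) :
    ‖M‖ ^ 2 = ∑ i, ∑ k, ‖M i k‖ ^ 2 := by
  rw [Matrix.frobenius_norm_def, ← Real.sqrt_eq_rpow, Real.sq_sqrt]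
  · simp
  · positivity

lemma re_le_lambdaMax {n : ℕ} (A : Matrix (Fin n) (Fin n) ℝ) {μ : ℂ}
    (hμ : μ ∈ spectrum ℂ (A.map (algebraMap ℝ ℂ))) : μ.re ≤ lambdaMax A :=
  le_csSup ((Matrix.finite_spectrum (A.map (algebraMap ℝ ℂ))).image _).bddAbove
    (mem_image_of_mem _ hμ)

lemma exp_mulVec_eq_sum_of_pow_mulVec_eq_zero {n : ℕ} {M : Matrix (Fin n) (Fin n) ℂ}
    {v : Fin n → ℂ} {k : ℕ} (hk : (M ^ k) *ᵥ v = 0) (s : ℝ) :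
    exp (s • M) *ᵥ v = ∑ i ∈ Finset.range k, (s ^ i / i.factorial) • ((M ^ i) *ᵥ v) := by
  have h1 := NormedSpace.exp_series_hasSum_exp' (𝕂 := ℝ) (s • M)
  let Λ : Matrix (Fin n) (Fin n) ℂ →ₗ[ℝ] (Fin n → ℂ) :=
    { toFun := fun M => M *ᵥ v
      map_add' := fun M M' => Matrix.add_mulVec _ _ _
      map_smul' := fun c M => Matrix.smul_mulVec _ _ _ }
  have h2 := h1.mapL (LinearMap.toContinuousLinearMap Λ)
  have h3 : ∀ i, (LinearMap.toContinuousLinearMap Λ) ((i.factorial : ℝ)⁻¹ • (s • M) ^ i) =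
      (s ^ i / i.factorial) • ((M ^ i) *ᵥ v) := by
    intro i
    rw [LinearMap.coe_toContinuousLinearMap', map_smul, smul_pow, map_smul, smul_smul,
      div_eq_inv_mul]
    rfl
  simp only [h3] at h2
  refine h2.unique (hasSum_sum_of_ne_finset_zero fun i hi => ?_)
  have hi' : k ≤ i := by simpa using hi
  have h4 : M ^ i = M ^ (i - k) * M ^ k := by rw [← pow_add, Nat.sub_add_cancel hi']
  rw [h4, ← Matrix.mulVec_mulVec, hk, Matrix.mulVec_zero, smul_zero]

lemma exists_norm_exp_mulVec_le_of_pow_mulVec_eq_zero {n : ℕ} {M : Matrix (Fin n) (Fin n) ℂ}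
    {μ : ℂ} {v : Fin n → ℂ} {k : ℕ} (hk : ((M - μ • 1) ^ k) *ᵥ v = 0) {b : ℝ} (hb : μ.re < b) :
    ∃ c : ℝ, ∀ s : ℝ, 0 ≤ s → ‖exp (s • M) *ᵥ v‖ ≤ c * Real.exp (b * s) := by
  set D := M - μ • (1 : Matrix (Fin n) (Fin n) ℂ) with hD
  set ε := b - μ.re with hε
  have hε0 : 0 < ε := sub_pos.2 hb
  refine ⟨∑ i ∈ Finset.range k, (ε ^ i)⁻¹ * ‖(D ^ i) *ᵥ v‖, fun s hs => ?_⟩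
  have h1 : exp (s • M) = Complex.exp (s * μ) • exp (s • D) := by
    have h2 : s • M = (s * μ : ℂ) • (1 : Matrix (Fin n) (Fin n) ℂ) + s • D := by
      rw [hD, smul_sub, mul_smul, ← Complex.coe_smul, ← Complex.coe_smul]; abel
    rw [h2, Matrix.exp_add_of_commute _ _ ((Commute.one_left _).smul_left _)]
    have h3 : exp ((s * μ : ℂ) • (1 : Matrix (Fin n) (Fin n) ℂ)) = Complex.exp (s * μ) • 1 := by
      rw [← Algebra.algebraMap_eq_smul_one, ← Algebra.algebraMap_eq_smul_one,
        Complex.exp_eq_exp_ℂ]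
      exact (NormedSpace.algebraMap_exp_comm (𝕂 := ℂ) _).symm
    rw [h3, smul_one_mul]
  rw [h1, Matrix.smul_mulVec, norm_smul, Complex.norm_exp,
    exp_mulVec_eq_sum_of_pow_mulVec_eq_zero hk]
  have h4 : ∀ i, s ^ i / i.factorial ≤ (ε ^ i)⁻¹ * Real.exp (ε * s) := fun i => by
    have := Real.pow_div_factorial_le_exp (ε * s) (by positivity) i
    rw [mul_pow, mul_div_assoc] at this
    rw [inv_mul_eq_div, le_div_iff₀ (by positivity), mul_comm]
    exact this
  have h5 : ‖∑ i ∈ Finset.range k, (s ^ i / i.factorial) • ((D ^ i) *ᵥ v)‖ ≤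
      (∑ i ∈ Finset.range k, (ε ^ i)⁻¹ * ‖(D ^ i) *ᵥ v‖) * Real.exp (ε * s) := by
    refine (norm_sum_le _ _).trans ?_
    rw [Finset.sum_mul]
    refine Finset.sum_le_sum fun i _ => ?_
    rw [norm_smul, Real.norm_of_nonneg (by positivity), mul_right_comm]
    exact mul_le_mul_of_nonneg_right (h4 i) (norm_nonneg _)
  have h6 : ((s * μ : ℂ)).re = s * μ.re := by simp
  rw [h6]
  calc _ ≤ Real.exp (s * μ.re) * ((∑ i ∈ Finset.range k, (ε ^ i)⁻¹ * ‖(D ^ i) *ᵥ v‖) *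
        Real.exp (ε * s)) := by gcongr
    _ = (∑ i ∈ Finset.range k, (ε ^ i)⁻¹ * ‖(D ^ i) *ᵥ v‖) *
        (Real.exp (s * μ.re) * Real.exp (ε * s)) := by ring
    _ = _ := by rw [← Real.exp_add, hε]; ring_nf

lemma exists_norm_exp_map_mulVec_le {n : ℕ} (A : Matrix (Fin n) (Fin n) ℝ) {b : ℝ}
    (hb : lambdaMax A < b) (v : Fin n → ℂ) :
    ∃ c : ℝ, ∀ s : ℝ, 0 ≤ s →
      ‖exp (s • A.map (algebraMap ℝ ℂ)) *ᵥ v‖ ≤ c * Real.exp (b * s) := by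
  set M := A.map (algebraMap ℝ ℂ)
  have hv : v ∈ ⨆ μ, Module.End.maxGenEigenspace (Matrix.toLinAlgEquiv' M) μ := by
    rw [Module.End.iSup_maxGenEigenspace_eq_top]; trivial
  induction hv using Submodule.iSup_induction' with
  | mem μ v hv =>
    obtain ⟨k, hk⟩ := Module.End.mem_maxGenEigenspace _ _ _ |>.1 hv
    have hk' : ((M - μ • 1) ^ k) *ᵥ v = 0 := by
      rw [← hk, ← Matrix.toLinAlgEquiv'_apply, map_pow, map_sub, map_smul, map_one]
    by_cases hμ : μ ∈ spectrum ℂ M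
    · exact exists_norm_exp_mulVec_le_of_pow_mulVec_eq_zero hk' ((re_le_lambdaMax A hμ).trans_lt hb)
    · have hu : IsUnit ((M - μ • 1) ^ k) := by
        refine IsUnit.pow k ?_
        rw [spectrum.notMem_iff, Algebra.algebraMap_eq_smul_one] at hμ
        rw [← neg_sub]; exact hμ.neg
      have : v = 0 := by
        refine Matrix.mulVec_injective_of_isUnit hu ?_
        rw [hk', Matrix.mulVec_zero]
      exact ⟨0, fun s _ => by simp [this]⟩
  | zero => exact ⟨0, fun s _ => by simp⟩
  | add v w _ _ hv hw =>
    obtain ⟨c, hc⟩ := hv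
    obtain ⟨d, hd⟩ := hw
    refine ⟨c + d, fun s hs => ?_⟩
    rw [Matrix.mulVec_add, add_mul]
    exact (norm_add_le _ _).trans (add_le_add (hc s hs) (hd s hs))

/-- The growth of `e^{sA}` is governed by the largest real part of the eigenvalues of `A`. -/
theorem exists_norm_exp_le {n : ℕ} (A : Matrix (Fin n) (Fin n) ℝ) {b : ℝ}
    (hb : lambdaMax A < b) :
    ∃ c : ℝ, 1 ≤ c ∧ ∀ s : ℝ, 0 ≤ s → ‖exp (s • A)‖ ≤ c * Real.exp (b * s) := by
  choose c hc using fun k : Fin n => exists_norm_exp_map_mulVec_le A hb (Pi.single k 1)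
  refine ⟨1 + √(∑ _i : Fin n, ∑ k, c k ^ 2), le_add_of_nonneg_right (Real.sqrt_nonneg _),
    fun s hs => ?_⟩
  have hmap : (exp (s • A)).map (algebraMap ℝ ℂ) = exp (s • A.map (algebraMap ℝ ℂ)) := by
    have h1 := NormedSpace.map_exp ((algebraMap ℝ ℂ).mapMatrix (m := Fin n))
      (by exact continuous_id.matrix_map Complex.continuous_ofReal) (s • A)
    rw [RingHom.mapMatrix_apply, RingHom.mapMatrix_apply] at h1
    refine h1.trans ?_
    congr 1
    ext i k
    simp
  have hn : ‖exp (s • A)‖ = ‖exp (s • A.map (algebraMap ℝ ℂ))‖ := by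
    rw [← hmap, Matrix.frobenius_norm_map_eq]; simp
  have hsq : ‖exp (s • A)‖ ^ 2 ≤ (√(∑ _i : Fin n, ∑ k, c k ^ 2) * Real.exp (b * s)) ^ 2 := by
    rw [hn, frobenius_norm_sq, mul_pow, Real.sq_sqrt (by positivity), Finset.sum_mul]
    refine Finset.sum_le_sum fun i _ => ?_
    rw [Finset.sum_mul]
    refine Finset.sum_le_sum fun k _ => ?_
    rw [← mul_pow]
    refine pow_le_pow_left₀ (norm_nonneg _) ?_ 2
    refine le_trans ?_ (hc k s hs)
    have := norm_le_pi_norm (exp (s • A.map (algebraMap ℝ ℂ)) *ᵥ Pi.single k 1) i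
    simpa using this
  refine (abs_le_of_sq_le_sq' hsq (by positivity)).2.trans ?_
  gcongr
  linarith

section kernel
variable {N : ℕ}

/-- The matrix of the orthogonal projection onto the kernel of the leader-follower matrix. -/
def kerMatrix (G : Digraph (Fin (N + 1))) : Matrix (Fin N) (Fin N) ℝ :=
  (Matrix.toEuclideanCLM (n := Fin N) (𝕜 := ℝ)).symm (kerProjection G)

lemma toEuclideanCLM_kerMatrix (G : Digraph (Fin (N + 1))) :
    Matrix.toEuclideanCLM (n := Fin N) (𝕜 := ℝ) (kerMatrix G) = kerProjection G :=
  (Matrix.toEuclideanCLM (n := Fin N) (𝕜 := ℝ)).apply_symm_apply _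

lemma kerMatrix_mulVec (G : Digraph (Fin (N + 1))) (x : Fin N → ℝ) :
    kerMatrix G *ᵥ x = (kerProjection G (WithLp.toLp 2 x)).ofLp := by
  rw [← toEuclideanCLM_kerMatrix, Matrix.ofLp_toEuclideanCLM]

lemma leaderFollowerMatrix_mul_kerMatrix (G : Digraph (Fin (N + 1))) :
    leaderFollowerMatrix G * kerMatrix G = 0 := by
  refine Matrix.ext_of_mulVec_single fun i => ?_
  rw [← Matrix.mulVec_mulVec, kerMatrix_mulVec, Matrix.zero_mulVec]
  have h := (LinearMap.ker (Matrix.toEuclideanLin (leaderFollowerMatrix G))).starProjection_apply_mem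
    (WithLp.toLp 2 (Pi.single i 1))
  have h' := congrArg WithLp.ofLp (LinearMap.mem_ker.1 h)
  rwa [Matrix.toLpLin_apply] at h'

lemma kerMatrix_mulVec_of_mulVec_eq_zero {G : Digraph (Fin (N + 1))} {y : Fin N → ℝ}
    (hy : leaderFollowerMatrix G *ᵥ y = 0) : kerMatrix G *ᵥ y = y := by
  rw [kerMatrix_mulVec, kerProjection, Submodule.starProjection_eq_self_iff.2]
  rw [LinearMap.mem_ker, Matrix.toLpLin_apply, WithLp.ofLp_toLp, hy]; rfl

lemma kerMatrix_mul_self (G : Digraph (Fin (N + 1))) : kerMatrix G * kerMatrix G = kerMatrix G := by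
  refine Matrix.ext_of_mulVec_single fun i => ?_
  rw [← Matrix.mulVec_mulVec]
  refine kerMatrix_mulVec_of_mulVec_eq_zero ?_
  rw [Matrix.mulVec_mulVec, leaderFollowerMatrix_mul_kerMatrix, Matrix.zero_mulVec]

lemma transpose_kerMatrix (G : Digraph (Fin (N + 1))) : (kerMatrix G)ᵀ = kerMatrix G := by
  have h : star (kerProjection G) = kerProjection G :=
    (isSelfAdjoint_starProjection (LinearMap.ker
      (Matrix.toEuclideanLin (leaderFollowerMatrix G))))
  rw [← Matrix.conjTranspose_eq_transpose_of_trivial, ← Matrix.star_eq_conjTranspose]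
  exact ((Matrix.toEuclideanCLM (n := Fin N) (𝕜 := ℝ)).symm.map_star' (kerProjection G)).symm.trans
    (congrArg _ h)

lemma kerMatrix_mul_leaderFollowerMatrix {G : Digraph (Fin (N + 1))}
    (hG : Undirected (followerGraph G)) : kerMatrix G * leaderFollowerMatrix G = 0 := by
  rw [← Matrix.transpose_inj, Matrix.transpose_mul, transpose_kerMatrix,
    isSymm_leaderFollowerMatrix hG, leaderFollowerMatrix_mul_kerMatrix, Matrix.transpose_zero]

lemma dotProduct_self_le_of_kerMatrix_mulVec_eq_zero {G : Digraph (Fin (N + 1))} (h : Loopless G)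
    (hG : Undirected (followerGraph G)) {z : Fin N → ℝ} (hz : kerMatrix G *ᵥ z = 0) :
    z ⬝ᵥ z ≤ 1 / lambdaH N * (z ⬝ᵥ (leaderFollowerMatrix G *ᵥ z)) := by
  refine dotProduct_self_le_of_orthogonal_ker h hG fun y hy => ?_
  rw [← kerMatrix_mulVec_of_mulVec_eq_zero hy, ← transpose_kerMatrix, Matrix.mulVec_transpose,
    ← Matrix.dotProduct_mulVec, hz, dotProduct_zero]

/-- The Frobenius norm of a product, when the left factor is measured in the spectral norm. -/
lemma frobenius_norm_mul_le {n : ℕ} (Q : Matrix (Fin N) (Fin N) ℝ) (X : Matrix (Fin N) (Fin n) ℝ) :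
    ‖Q * X‖ ≤ ‖Matrix.toEuclideanCLM (n := Fin N) (𝕜 := ℝ) Q‖ * ‖X‖ := by
  refine (abs_le_of_sq_le_sq' ?_ (by positivity)).2
  have hcol : ∀ Y : Matrix (Fin N) (Fin n) ℝ,
      ‖Y‖ ^ 2 = ∑ k, ‖(WithLp.toLp 2 (fun i => Y i k) : EuclideanSpace ℝ (Fin N))‖ ^ 2 := fun Y => by
    rw [frobenius_norm_sq, Finset.sum_comm]
    simp [EuclideanSpace.norm_sq_eq]
  rw [mul_pow, hcol, hcol, Finset.mul_sum]
  refine Finset.sum_le_sum fun k _ => ?_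
  rw [← mul_pow]
  refine pow_le_pow_left₀ (norm_nonneg _) ?_ 2
  have := (Matrix.toEuclideanCLM (n := Fin N) (𝕜 := ℝ) Q).le_opNorm (WithLp.toLp 2 fun i => X i k)
  rwa [Matrix.toEuclideanCLM_toLp] at this

lemma norm_toEuclideanCLM_kerMatrix_le (G : Digraph (Fin (N + 1))) :
    ‖Matrix.toEuclideanCLM (n := Fin N) (𝕜 := ℝ) (kerMatrix G)‖ ≤ 1 := by
  rw [toEuclideanCLM_kerMatrix]
  exact Submodule.starProjection_norm_le _

lemma norm_kerMatrix_mul_le {n : ℕ} (G : Digraph (Fin (N + 1))) (X : Matrix (Fin N) (Fin n) ℝ) :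
    ‖kerMatrix G * X‖ ≤ ‖X‖ :=
  (frobenius_norm_mul_le _ _).trans (mul_le_of_le_one_left (norm_nonneg _)
    (norm_toEuclideanCLM_kerMatrix_le G))

end kernel

section trace

lemma trace_mul_mul_transpose {l n : ℕ} (Y : Matrix (Fin l) (Fin n) ℝ)
    (W : Matrix (Fin n) (Fin n) ℝ) :
    (Y * W * Yᵀ).trace = ∑ i, Y i ⬝ᵥ (W *ᵥ Y i) := by
  simp only [Matrix.trace, Matrix.diag_apply]
  refine Finset.sum_congr rfl fun i _ => ?_
  rw [Matrix.mul_assoc, Matrix.mul_apply]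
  refine Finset.sum_congr rfl fun k _ => ?_
  congr 1

lemma frobenius_norm_sq_eq_sum_dotProduct {l n : ℕ} (Y : Matrix (Fin l) (Fin n) ℝ) :
    ‖Y‖ ^ 2 = ∑ i, Y i ⬝ᵥ Y i := by
  rw [frobenius_norm_sq]; simp [dotProduct, sq]

lemma trace_mul_transpose_self {l n : ℕ} (Y : Matrix (Fin l) (Fin n) ℝ) :
    (Y * Yᵀ).trace = ∑ i, Y i ⬝ᵥ Y i := by
  simpa using trace_mul_mul_transpose Y 1

lemma hasDerivWithinAt_trace_mul_mul_transpose {l n : ℕ} {Y : ℝ → Matrix (Fin l) (Fin n) ℝ}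
    {Y' : Matrix (Fin l) (Fin n) ℝ} {W : Matrix (Fin n) (Fin n) ℝ} (hW : Wᵀ = W) {S : Set ℝ}
    {s : ℝ} (hY : HasDerivWithinAt Y Y' S s) :
    HasDerivWithinAt (fun s => (Y s * W * (Y s)ᵀ).trace) (2 * (Y' * W * (Y s)ᵀ).trace) S s := by
  have hT : HasDerivWithinAt (fun s => (Y s)ᵀ) Y'ᵀ S s :=
    hasDerivWithinAt_matrix_iff.2 fun i k => hasDerivWithinAt_matrix_iff.1 hY k i
  have h1 := (hY.matrixMul (hasDerivWithinAt_const s S W)).matrixMul hT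
  have h2 := HasDerivWithinAt.fun_sum (u := Finset.univ) fun (i : Fin l) _ =>
    hasDerivWithinAt_matrix_iff.1 h1 i i
  refine h2.congr_deriv ?_
  have h3 : (Y s * W * Y'ᵀ).trace = (Y' * W * (Y s)ᵀ).trace := by
    rw [← Matrix.trace_transpose, Matrix.transpose_mul, Matrix.transpose_mul, hW,
      Matrix.transpose_transpose, Matrix.mul_assoc]
  calc _ = ((Y' * W + Y s * (0 : Matrix (Fin n) (Fin n) ℝ)) * (Y s)ᵀ + Y s * W * Y'ᵀ).trace := rfl
    _ = _ := by rw [Matrix.mul_zero, add_zero, Matrix.trace_add, h3]; ring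

end trace

section dwell
variable {n m N : ℕ} {A : Matrix (Fin n) (Fin n) ℝ} {C : Matrix (Fin m) (Fin n) ℝ}
  {G : Digraph (Fin (N + 1))}

lemma transpose_observerGain_mul_mul_weightedGramian (hobs : Observable C A) {μ α T : ℝ}
    (hT : 0 < T) : (observerGain A C μ α T * C)ᵀ * weightedGramian A C α T = μ • (Cᵀ * C) := by
  have hu : IsUnit (weightedGramian A C α T).det :=
    (Matrix.isUnit_iff_isUnit_det _).1 (posDef_weightedGramian hobs α hT).isUnit
  rw [observerGain, Matrix.smul_mul, Matrix.transpose_smul, Matrix.smul_mul,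
    Matrix.transpose_mul, Matrix.transpose_mul, Matrix.transpose_nonsing_inv,
    transpose_weightedGramian, Matrix.transpose_transpose, Matrix.mul_assoc, Matrix.mul_assoc,
    Matrix.nonsing_inv_mul _ hu, Matrix.mul_one]

/-- The Lyapunov inequality of the fast part of the error dynamics. -/
lemma lyapunov_inequality (hG : Loopless G) (hund : Undirected (followerGraph G))
    (hobs : Observable C A) {μ α T : ℝ} (hT : 0 < T) (hμ : 1 / lambdaH N ≤ μ)
    {Y : Matrix (Fin N) (Fin n) ℝ} (hY : kerMatrix G * Y = 0) :
    2 * ((Y * Aᵀ - leaderFollowerMatrix G * Y * (observerGain A C μ α T * C)ᵀ) *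
      weightedGramian A C α T * Yᵀ).trace ≤
      -(2 * α) * (Y * weightedGramian A C α T * Yᵀ).trace := by
  set W := weightedGramian A C α T with hW
  set H := leaderFollowerMatrix G
  set Z := Y * Cᵀ with hZ
  have h1 : (Y * Aᵀ * W * Yᵀ).trace = (Y * (W * A) * Yᵀ).trace := by
    rw [← Matrix.trace_transpose]
    simp only [Matrix.transpose_mul, Matrix.transpose_transpose, hW, transpose_weightedGramian,
      Matrix.mul_assoc]
  have h2 : 2 * (Y * Aᵀ * W * Yᵀ).trace = (Y * (Aᵀ * W + W * A) * Yᵀ).trace := by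
    rw [Matrix.mul_add, Matrix.add_mul, Matrix.trace_add, ← h1, two_mul, ← Matrix.mul_assoc Y Aᵀ]
  have h3 : 2 * (Y * Aᵀ * W * Yᵀ).trace = -(2 * α) * (Y * W * Yᵀ).trace +
      2 * (Z * Zᵀ).trace - 2 * (Y * gramianIntegrand A C α T * Yᵀ).trace := by
    rw [h2, hW, weightedGramian_lyapunov, hZ]
    simp only [Matrix.mul_add, Matrix.mul_sub, Matrix.add_mul, Matrix.sub_mul, Matrix.trace_add,
      Matrix.trace_sub, Matrix.mul_smul, Matrix.smul_mul, Matrix.trace_smul, smul_eq_mul,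
      Matrix.transpose_mul, Matrix.transpose_transpose, Matrix.mul_assoc]
  have h4 : (H * Y * (observerGain A C μ α T * C)ᵀ * W * Yᵀ).trace = μ * (Zᵀ * H * Z).trace := by
    rw [Matrix.mul_assoc (H * Y), hW, transpose_observerGain_mul_mul_weightedGramian hobs hT,
      Matrix.mul_smul, Matrix.smul_mul, Matrix.trace_smul, smul_eq_mul, Matrix.mul_assoc Zᵀ,
      Matrix.trace_mul_comm Zᵀ, hZ]
    simp only [Matrix.transpose_mul, Matrix.transpose_transpose, Matrix.mul_assoc]
  have h5 : (Zᵀ * H * Z).trace = ∑ k, Zᵀ k ⬝ᵥ (H *ᵥ Zᵀ k) := trace_mul_mul_transpose Zᵀ H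
  have h6 : (Z * Zᵀ).trace = ∑ k, Zᵀ k ⬝ᵥ Zᵀ k := by
    rw [Matrix.trace_mul_comm]; exact trace_mul_transpose_self Zᵀ
  have h7 : (Z * Zᵀ).trace ≤ μ * (Zᵀ * H * Z).trace := by
    rw [h5, h6, Finset.mul_sum]
    refine Finset.sum_le_sum fun k _ => ?_
    refine (dotProduct_self_le_of_kerMatrix_mulVec_eq_zero hG hund ?_).trans
      (mul_le_mul_of_nonneg_right hμ (leaderFollowerMatrix_quadratic_nonneg hG hund _))
    have h8 : kerMatrix G * Z = 0 := by rw [hZ, ← Matrix.mul_assoc, hY, Matrix.zero_mul]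
    ext i
    exact congrFun (congrFun h8 i) k
  have h9 : 0 ≤ (Y * gramianIntegrand A C α T * Yᵀ).trace := by
    rw [trace_mul_mul_transpose]
    exact Finset.sum_nonneg fun i _ => dotProduct_gramianIntegrand_mulVec_nonneg A C α T _
  rw [Matrix.sub_mul, Matrix.sub_mul, Matrix.trace_sub, h4, mul_sub, h3]
  linarith

lemma kerMatrix_mul_eq {K : Matrix (Fin n) (Fin n) ℝ} (hund : Undirected (followerGraph G))
    {X : ℝ → Matrix (Fin N) (Fin n) ℝ} {a b : ℝ} (hc : ContinuousOn X (Icc a b))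
    (hX : ∀ s ∈ Ico a b, HasDerivWithinAt X (X s * Aᵀ - leaderFollowerMatrix G * X s * Kᵀ)
      (Ici s) s) {s : ℝ} (hs : s ∈ Icc a b) :
    kerMatrix G * X s = kerMatrix G * X a * exp ((s - a) • Aᵀ) := by
  refine eq_mul_exp_of_hasDerivWithinAt (X := fun s => kerMatrix G * X s)
    (continuousOn_const.matrixMul hc) (fun s hs => ?_) hs
  refine ((hasDerivWithinAt_const s (Ici s) (kerMatrix G)).matrixMul (hX s hs)).congr_deriv ?_
  rw [Matrix.zero_mul, zero_add, Matrix.mul_sub, ← Matrix.mul_assoc, ← Matrix.mul_assoc,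
    ← Matrix.mul_assoc, kerMatrix_mul_leaderFollowerMatrix hund, Matrix.zero_mul, Matrix.zero_mul,
    sub_zero]

/-- The Lyapunov function of the fast part of the error decays at the rate `2α`. -/
lemma trace_fast_part_le (hG : Loopless G) (hund : Undirected (followerGraph G))
    (hobs : Observable C A) {μ α T : ℝ} (hT : 0 < T) (hμ : 1 / lambdaH N ≤ μ)
    {X : ℝ → Matrix (Fin N) (Fin n) ℝ} {a b : ℝ} (hab : a ≤ b) (hc : ContinuousOn X (Icc a b))
    (hX : ∀ s ∈ Ico a b, HasDerivWithinAt X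
      (X s * Aᵀ - leaderFollowerMatrix G * X s * (observerGain A C μ α T * C)ᵀ) (Ici s) s) :
    ((X b - kerMatrix G * X b) * weightedGramian A C α T * (X b - kerMatrix G * X b)ᵀ).trace ≤
      Real.exp (-(2 * α) * (b - a)) * ((X a - kerMatrix G * X a) * weightedGramian A C α T *
        (X a - kerMatrix G * X a)ᵀ).trace := by
  set W := weightedGramian A C α T
  set P := kerMatrix G
  set H := leaderFollowerMatrix G
  set K := observerGain A C μ α T * C
  set Y : ℝ → Matrix (Fin N) (Fin n) ℝ := fun s => X s - P * X s with hYdef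
  have hPY : ∀ s, P * Y s = 0 := fun s => by
    simp only [hYdef, P]
    rw [Matrix.mul_sub, ← Matrix.mul_assoc, kerMatrix_mul_self, sub_self]
  have hHY : ∀ s, H * Y s = H * X s := fun s => by
    simp only [hYdef, P, H]
    rw [Matrix.mul_sub, ← Matrix.mul_assoc, leaderFollowerMatrix_mul_kerMatrix, Matrix.zero_mul,
      sub_zero]
  have hY : ∀ s ∈ Ico a b, HasDerivWithinAt Y (Y s * Aᵀ - H * Y s * Kᵀ) (Ici s) s := by
    intro s hs
    have h1 := (hX s hs).sub ((hasDerivWithinAt_const s (Ici s) P).matrixMul (hX s hs))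
    refine h1.congr_deriv ?_
    rw [hHY]
    simp only [hYdef]
    have h2 : P * (H * X s * Kᵀ) = 0 := by
      rw [← Matrix.mul_assoc, ← Matrix.mul_assoc, kerMatrix_mul_leaderFollowerMatrix hund,
        Matrix.zero_mul, Matrix.zero_mul]
    rw [Matrix.mul_sub, h2, Matrix.sub_mul, Matrix.zero_mul, zero_add, sub_zero, Matrix.mul_assoc P]
    abel
  have hYc : ContinuousOn Y (Icc a b) := hc.sub (continuousOn_const.matrixMul hc)
  have hYT : ContinuousOn (fun s => (Y s)ᵀ) (Icc a b) :=
    continuous_id.matrix_transpose.comp_continuousOn hYc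
  set V : ℝ → ℝ := fun s => (Y s * W * (Y s)ᵀ).trace with hV
  have hVc : ContinuousOn V (Icc a b) :=
    continuous_id.matrix_trace.comp_continuousOn
      ((hYc.matrixMul continuousOn_const).matrixMul hYT)
  have hexp : ∀ s, HasDerivAt (fun s => Real.exp (2 * α * (s - a)))
      (Real.exp (2 * α * (s - a)) * (2 * α)) s := fun s => by
    simpa using (((hasDerivAt_id s).sub_const a).const_mul (2 * α)).exp
  have key := image_le_of_deriv_right_le_deriv_boundary
    (f := fun s => Real.exp (2 * α * (s - a)) * V s)
    (f' := fun s => Real.exp (2 * α * (s - a)) * (2 * α) * V s +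
      Real.exp (2 * α * (s - a)) * (2 * ((Y s * Aᵀ - H * Y s * Kᵀ) * W * (Y s)ᵀ).trace))
    (B := fun _ => V a) (B' := fun _ => 0) (a := a) (b := b)
    (ContinuousOn.mul (fun s _ => (hexp s).continuousAt.continuousWithinAt) hVc)
    (fun s hs => (hexp s).hasDerivWithinAt.mul
      (hasDerivWithinAt_trace_mul_mul_transpose (transpose_weightedGramian A C α T) (hY s hs)))
    (by simp) continuousOn_const (fun s _ => hasDerivWithinAt_const s _ _)
    (fun s _ => by
      have h1 := lyapunov_inequality hG hund hobs (α := α) hT hμ (hPY s)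
      have h2 := mul_le_mul_of_nonneg_left h1 (Real.exp_pos (2 * α * (s - a))).le
      simp only [hV]
      linarith) (right_mem_Icc.2 hab)
  have h1 : Real.exp (-(2 * α) * (b - a)) * (Real.exp (2 * α * (b - a)) * V b) = V b := by
    rw [← mul_assoc, ← Real.exp_add]; simp
  calc V b = _ := h1.symm
    _ ≤ _ := mul_le_mul_of_nonneg_left key (Real.exp_pos _).le

/-- Over a dwell interval, the error follows the slow dynamics on the kernel of the
leader-follower matrix, up to a part that is small when `α` is large. -/
theorem exists_norm_sub_slow_part_le (hobs : Observable C A) {T τ : ℝ} (hT : 0 < T) (hτ : 0 < τ) :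
    ∃ κ : ℝ, 0 ≤ κ ∧ ∀ (N : ℕ) (G : Digraph (Fin (N + 1))) (α μ : ℝ), Loopless G →
      Undirected (followerGraph G) → 0 ≤ α → 1 / lambdaH N ≤ μ →
      ∀ (X : ℝ → Matrix (Fin N) (Fin n) ℝ) (a b : ℝ), a + τ ≤ b → ContinuousOn X (Icc a b) →
      (∀ s ∈ Ico a b, HasDerivWithinAt X
        (X s * Aᵀ - leaderFollowerMatrix G * X s * (observerGain A C μ α T * C)ᵀ) (Ici s) s) →
      ‖X b - kerMatrix G * X a * exp ((b - a) • Aᵀ)‖ ≤ κ * Real.exp (-(α * τ / 2)) * ‖X a‖ := by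
  set h := min T (τ / 2)
  have hh : 0 < h := lt_min hT (by positivity)
  obtain ⟨c, hc, hlow⟩ := exists_mul_le_dotProduct_mulVec (posDef_weightedGramian hobs 0 hh)
  obtain ⟨D, hD, hup⟩ : ∃ D : ℝ, 0 ≤ D ∧ ∀ x : Fin n → ℝ,
      x ⬝ᵥ (weightedGramian A C 0 T *ᵥ x) ≤ D * (x ⬝ᵥ x) := by
    refine ⟨‖Matrix.toEuclideanCLM (n := Fin n) (𝕜 := ℝ) (weightedGramian A C 0 T)‖,
      norm_nonneg _, fun x => ?_⟩
    set y : EuclideanSpace ℝ (Fin n) := WithLp.toLp 2 x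
    have h1 := real_inner_le_norm
      (Matrix.toEuclideanCLM (n := Fin n) (𝕜 := ℝ) (weightedGramian A C 0 T) y) y
    have h2 := (Matrix.toEuclideanCLM (n := Fin n) (𝕜 := ℝ) (weightedGramian A C 0 T)).le_opNorm y
    have h3 : x ⬝ᵥ x = ‖y‖ ^ 2 := by
      rw [EuclideanSpace.norm_sq_eq]; simp [dotProduct, sq, y]
    have h4 : inner ℝ (Matrix.toEuclideanCLM (n := Fin n) (𝕜 := ℝ) (weightedGramian A C 0 T) y) y =
        x ⬝ᵥ (weightedGramian A C 0 T *ᵥ x) := by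
      rw [EuclideanSpace.inner_eq_star_dotProduct, Matrix.ofLp_toEuclideanCLM]; simp [y]
    rw [h4] at h1
    rw [h3]
    nlinarith [norm_nonneg y]
  refine ⟨√(4 * D / c), Real.sqrt_nonneg _, ?_⟩
  intro N G α μ hG hund hα hμ X a b hab hXc hX
  have hab' : a ≤ b := by linarith
  have hPX := kerMatrix_mul_eq hund hXc hX (right_mem_Icc.2 hab')
  rw [← hPX]
  set Y : ℝ → Matrix (Fin N) (Fin n) ℝ := fun s => X s - kerMatrix G * X s
  have hV := trace_fast_part_le hG hund hobs hT hμ hab' hXc hX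
  rw [trace_mul_mul_transpose, trace_mul_mul_transpose] at hV
  have h1 : Real.exp (-α * h) * (c * ‖Y b‖ ^ 2) ≤
      ∑ i, Y b i ⬝ᵥ (weightedGramian A C α T *ᵥ Y b i) := by
    rw [frobenius_norm_sq_eq_sum_dotProduct, Finset.mul_sum, Finset.mul_sum]
    refine Finset.sum_le_sum fun i _ => ?_
    exact (mul_le_mul_of_nonneg_left (hlow _) (Real.exp_pos _).le).trans
      (exp_mul_le_dotProduct_weightedGramian_mulVec hα hh.le (min_le_left _ _) _)
  have h2 : ∑ i, Y a i ⬝ᵥ (weightedGramian A C α T *ᵥ Y a i) ≤ D * ‖Y a‖ ^ 2 := by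
    rw [frobenius_norm_sq_eq_sum_dotProduct, Finset.mul_sum]
    exact Finset.sum_le_sum fun i _ =>
      (dotProduct_weightedGramian_mulVec_le hα hT.le _).trans (hup _)
  have h3 : ‖Y a‖ ≤ 2 * ‖X a‖ := by
    have := norm_sub_le (X a) (kerMatrix G * X a)
    have := norm_kerMatrix_mul_le G (X a)
    simp only [Y]; linarith
  have h4 : Real.exp (-α * h) * (c * ‖Y b‖ ^ 2) ≤
      Real.exp (-(2 * α) * (b - a)) * (D * (2 * ‖X a‖) ^ 2) := by
    refine h1.trans (hV.trans (mul_le_mul_of_nonneg_left (h2.trans ?_) (Real.exp_pos _).le))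
    gcongr
  have h5 : ‖Y b‖ ^ 2 ≤ (√(4 * D / c) * Real.exp (-(α * τ / 2)) * ‖X a‖) ^ 2 := by
    have h6 : Real.exp (α * h) * Real.exp (-(2 * α) * (b - a)) ≤ Real.exp (-(α * τ / 2)) ^ 2 := by
      rw [← Real.exp_add, ← Real.exp_nat_mul]
      refine Real.exp_le_exp.2 ?_
      have h7 : α * h ≤ α * (τ / 2) := mul_le_mul_of_nonneg_left (min_le_right _ _) hα
      have h8 : α * τ ≤ α * (b - a) := mul_le_mul_of_nonneg_left (by linarith) hα
      have h9 : 0 ≤ α * τ := by positivity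
      push_cast
      linarith
    have h7 : c * ‖Y b‖ ^ 2 ≤ Real.exp (-(α * τ / 2)) ^ 2 * (D * (2 * ‖X a‖) ^ 2) := by
      calc c * ‖Y b‖ ^ 2 = Real.exp (α * h) * (Real.exp (-α * h) * (c * ‖Y b‖ ^ 2)) := by
            rw [← mul_assoc (Real.exp (α * h)), ← Real.exp_add]; simp
        _ ≤ Real.exp (α * h) * (Real.exp (-(2 * α) * (b - a)) * (D * (2 * ‖X a‖) ^ 2)) := by
            gcongr
        _ = Real.exp (α * h) * Real.exp (-(2 * α) * (b - a)) * (D * (2 * ‖X a‖) ^ 2) := by ring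
        _ ≤ _ := by gcongr
    rw [mul_pow, mul_pow, Real.sq_sqrt (by positivity)]
    rw [← mul_le_mul_iff_right₀ hc]
    calc _ ≤ _ := h7
      _ = _ := by field_simp; ring
  exact (abs_le_of_sq_le_sq' h5 (by positivity)).2

end dwell

lemma exists_mem_Ico_of_strictMono {u : ℕ → ℝ} (h0 : u 0 = 0)
    (hu : ∀ s, ∃ r, s < u r) {s : ℝ} (hs : 0 ≤ s) : ∃ r, s ∈ Ico (u r) (u (r + 1)) := by
  classical
  have hne : Nat.find (hu s) ≠ 0 := fun h => by
    have := Nat.find_spec (hu s)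
    rw [h, h0] at this
    linarith
  obtain ⟨r, hr⟩ := Nat.exists_eq_succ_of_ne_zero hne
  refine ⟨r, ?_, ?_⟩
  · have := Nat.find_min (hu s) (show r < Nat.find (hu s) by omega)
    exact not_lt.1 this
  · have := Nat.find_spec (hu s)
    rwa [hr] at this

lemma IsSwitchingSignal.exists_lt {n₀ : ℕ} {σ : ℝ → Fin n₀} {t : ℕ → ℝ} {τ : ℝ}
    (h : IsSwitchingSignal σ t τ) (s : ℝ) : ∃ r, s < t r := by
  obtain ⟨r, hr⟩ := exists_nat_gt (s / τ)
  refine ⟨r, ?_⟩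
  have := h.add_mul_le 0 r
  rw [h.zero, zero_add, zero_add] at this
  exact ((div_lt_iff₀ h.dwell_pos).1 hr).trans_le this

section perturbation
variable {N n : ℕ}

/-- A perturbed product of slow steps stays close to the exact product. -/
lemma norm_sub_orderedProd_le {A : Matrix (Fin n) (Fin n) ℝ} {P : ℕ → Matrix (Fin N) (Fin N) ℝ}
    (hP : ∀ (r : ℕ) (X : Matrix (Fin N) (Fin n) ℝ), ‖P r * X‖ ≤ ‖X‖)
    {t : ℕ → ℝ} {B ε : ℝ} (hB : 1 ≤ B) (hε : 0 ≤ ε)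
    (hexp : ∀ r, ‖exp ((t (r + 1) - t r) • Aᵀ)‖ ≤ B) {X : ℝ → Matrix (Fin N) (Fin n) ℝ}
    (hX : ∀ r, ‖X (t (r + 1)) - P r * X (t r) * exp ((t (r + 1) - t r) • Aᵀ)‖ ≤ ε * ‖X (t r)‖)
    (a l : ℕ) :
    ‖X (t (a + l)) - orderedProd P a l * X (t a) * exp ((t (a + l) - t a) • Aᵀ)‖ ≤
      ((B + ε) ^ l - B ^ l) * ‖X (t a)‖ := by
  have hB0 : 0 ≤ B := by linarith
  have hstep : ∀ (r : ℕ) (Z : Matrix (Fin N) (Fin n) ℝ),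
      ‖P r * Z * exp ((t (r + 1) - t r) • Aᵀ)‖ ≤ B * ‖Z‖ := fun r Z => by
    calc _ ≤ ‖P r * Z‖ * ‖exp ((t (r + 1) - t r) • Aᵀ)‖ := Matrix.frobenius_norm_mul _ _
      _ ≤ ‖Z‖ * B := mul_le_mul (hP r Z) (hexp r) (norm_nonneg _) (norm_nonneg _)
      _ = _ := mul_comm _ _
  have hgrow : ∀ l, ‖X (t (a + l))‖ ≤ (B + ε) ^ l * ‖X (t a)‖ := by
    intro l
    induction l with
    | zero => simp
    | succ l ih =>
      have h1 := norm_le_norm_add_norm_sub (P (a + l) * X (t (a + l)) *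
        exp ((t (a + l + 1) - t (a + l)) • Aᵀ)) (X (t (a + l + 1)))
      rw [norm_sub_rev] at h1
      have h2 := hX (a + l)
      have h3 := hstep (a + l) (X (t (a + l)))
      rw [← add_assoc, pow_succ]
      nlinarith [norm_nonneg (X (t (a + l)))]
  induction l with
  | zero => simp [orderedProd]
  | succ l ih =>
    have h1 : X (t (a + (l + 1))) - orderedProd P a (l + 1) * X (t a) *
          exp ((t (a + (l + 1)) - t a) • Aᵀ) =
        (X (t (a + l + 1)) - P (a + l) * X (t (a + l)) *
          exp ((t (a + l + 1) - t (a + l)) • Aᵀ)) +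
        P (a + l) * (X (t (a + l)) - orderedProd P a l * X (t a) *
          exp ((t (a + l) - t a) • Aᵀ)) * exp ((t (a + l + 1) - t (a + l)) • Aᵀ) := by
      have h2 : t (a + l + 1) - t a = t (a + l) - t a + (t (a + l + 1) - t (a + l)) := by ring
      rw [← add_assoc, h2, exp_add_smul, orderedProd]
      simp only [Matrix.mul_sub, Matrix.sub_mul, Matrix.mul_assoc]
      abel
    rw [h1]
    refine (norm_add_le _ _).trans ((add_le_add (hX (a + l)) (hstep (a + l) _)).trans ?_)
    have h2 := mul_le_mul_of_nonneg_left (hgrow l) hε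
    have h3 := mul_le_mul_of_nonneg_left ih hB0
    rw [pow_succ, pow_succ]
    linarith

lemma monotone_add_pow_sub_pow {B ε : ℝ} (hB : 1 ≤ B) (hε : 0 ≤ ε) :
    Monotone fun l : ℕ => (B + ε) ^ l - B ^ l := by
  refine monotone_nat_of_le_succ fun l => ?_
  have h1 : 0 ≤ (B + ε) ^ l - B ^ l :=
    sub_nonneg.2 (pow_le_pow_left₀ (by linarith) (by linarith) l)
  have h2 : 0 ≤ ε * (B + ε) ^ l := by positivity
  rw [pow_succ, pow_succ]
  nlinarith

end perturbation

section blocks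
variable {N n₀ : ℕ} {G : Fin n₀ → Digraph (Fin (N + 1))} {σ : ℝ → Fin n₀} {t : ℕ → ℝ} {τ : ℝ}
  {j : ℕ → ℕ} {Tc δ : ℝ}

lemma JointlyConnected.map_zero (hσ : IsSwitchingSignal σ t τ)
    (hconn : JointlyConnected G σ t j Tc) : j 0 = 0 :=
  hσ.strictMono.injective (hconn.zero.trans hσ.zero.symm)

lemma JointlyConnected.gap_le (hσ : IsSwitchingSignal σ t τ)
    (hconn : JointlyConnected G σ t j Tc) (r : ℕ) : t (r + 1) - t r ≤ Tc := by
  classical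
  have hex : ∃ k, r < j k := ⟨r + 1, hconn.strictMono.le_apply⟩
  have hne : Nat.find hex ≠ 0 := fun h => by
    have := Nat.find_spec hex
    rw [h, hconn.map_zero hσ] at this
    omega
  obtain ⟨k, hk⟩ := Nat.exists_eq_succ_of_ne_zero hne
  have h1 : j k ≤ r := not_lt.1 (Nat.find_min hex (show k < Nat.find hex by omega))
  have h2 : r < j (k + 1) := by
    have := Nat.find_spec hex
    rwa [hk] at this
  have h3 := hσ.strictMono.monotone h1
  have h4 := hσ.strictMono.monotone (Nat.succ_le_of_lt h2)
  have h5 := hconn.gap k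
  simp only [Nat.succ_eq_add_one] at h4
  linarith

lemma JointlyConnected.add_gap_le (hconn : JointlyConnected G σ t j Tc) (k K : ℕ) :
    t (j (k + K)) - t (j k) ≤ K * Tc := by
  induction K with
  | zero => simp
  | succ K ih =>
    have := hconn.gap (k + K)
    rw [← add_assoc]; push_cast; linarith

lemma JointlyConnected.add_length_le (hσ : IsSwitchingSignal σ t τ)
    (hconn : JointlyConnected G σ t j Tc) (k K : ℕ) :
    j (k + K) - j k ≤ K * ⌊Tc / τ⌋₊ := by
  induction K with
  | zero => simp
  | succ K ih =>
    have h1 := hconn.length_le hσ (k + K)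
    have h2 := hconn.strictMono.monotone (show k ≤ k + K by omega)
    have h3 := hconn.strictMono.monotone (show k + K ≤ k + K + 1 by omega)
    rw [← add_assoc, Nat.succ_mul]; omega

lemma IsContractionFactor.norm_orderedProd_le (hδ : IsContractionFactor G σ t j δ)
    (hconn : JointlyConnected G σ t j Tc) (k K : ℕ) :
    ‖orderedProd (fun r => kerProjection (G (σ (t r)))) (j k) (j (k + K) - j k)‖ ≤ δ ^ K := by
  induction K with
  | zero =>
    simp only [add_zero, Nat.sub_self, orderedProd, pow_zero]
    exact ContinuousLinearMap.norm_id_le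
  | succ K ih =>
    have h2 := hconn.strictMono.monotone (show k ≤ k + K by omega)
    have h3 := hconn.strictMono.monotone (show k + K ≤ k + K + 1 by omega)
    have h4 : j (k + (K + 1)) - j k = (j (k + K) - j k) + (j (k + K + 1) - j (k + K)) := by
      rw [← add_assoc]; omega
    rw [h4, orderedProd_add, Nat.add_sub_cancel' h2, pow_succ']
    exact (norm_mul_le _ _).trans (mul_le_mul (hδ.2.2 (k + K)) ih (norm_nonneg _) hδ.1.le)

/-- Over `K` consecutive connectivity intervals the error is at least halved. -/
lemma norm_le_half_of_blocks {n : ℕ} {A : Matrix (Fin n) (Fin n) ℝ}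
    (hσ : IsSwitchingSignal σ t τ) (hconn : JointlyConnected G σ t j Tc)
    (hδ : IsContractionFactor G σ t j δ) {b c ε : ℝ} (hb : 0 ≤ b) (hc : 1 ≤ c)
    (hexp : ∀ s : ℝ, 0 ≤ s → ‖exp (s • A)‖ ≤ c * Real.exp (b * s)) {K : ℕ}
    (hK : c * (δ * Real.exp (b * Tc)) ^ K ≤ 1 / 4) (hε : 0 ≤ ε)
    (hpow : (c * Real.exp (b * Tc) + ε) ^ (K * ⌊Tc / τ⌋₊) -
      (c * Real.exp (b * Tc)) ^ (K * ⌊Tc / τ⌋₊) ≤ 1 / 4)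
    {X : ℝ → Matrix (Fin N) (Fin n) ℝ}
    (hX : ∀ r, ‖X (t (r + 1)) - kerMatrix (G (σ (t r))) * X (t r) *
      exp ((t (r + 1) - t r) • Aᵀ)‖ ≤ ε * ‖X (t r)‖) (k : ℕ) :
    ‖X (t (j (k + K)))‖ ≤ 1 / 2 * ‖X (t (j k))‖ := by
  have hexpT : ∀ s : ℝ, ‖exp (s • Aᵀ)‖ = ‖exp (s • A)‖ := fun s => by
    rw [← Matrix.transpose_smul, Matrix.exp_transpose, Matrix.frobenius_norm_transpose]
  have hTc := hconn.Tc_pos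
  have hB : 1 ≤ c * Real.exp (b * Tc) :=
    one_le_mul_of_one_le_of_one_le hc (Real.one_le_exp (by positivity))
  have hstep : ∀ r, ‖exp ((t (r + 1) - t r) • Aᵀ)‖ ≤ c * Real.exp (b * Tc) := fun r => by
    rw [hexpT]
    refine (hexp _ (sub_nonneg.2 (hσ.strictMono.monotone (Nat.le_succ r)))).trans ?_
    gcongr
    exact hconn.gap_le hσ r
  set P : ℕ → Matrix (Fin N) (Fin N) ℝ := fun r => kerMatrix (G (σ (t r))) with hP
  have h1 := norm_sub_orderedProd_le (P := P) (A := A) (fun r X => norm_kerMatrix_mul_le _ X) hB hε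
    hstep hX (j k) (j (k + K) - j k)
  have hjk := hconn.strictMono.monotone (show k ≤ k + K by omega)
  rw [Nat.add_sub_cancel' hjk] at h1
  have h2 := (monotone_add_pow_sub_pow hB hε (hconn.add_length_le hσ k K)).trans hpow
  simp only at h2
  set Q := orderedProd P (j k) (j (k + K) - j k)
  set S := t (j (k + K)) - t (j k)
  have hQ : ‖Matrix.toEuclideanCLM (n := Fin N) (𝕜 := ℝ) Q‖ ≤ δ ^ K := by
    have h3 := hδ.norm_orderedProd_le hconn k K
    have h4 : Matrix.toEuclideanCLM (n := Fin N) (𝕜 := ℝ) Q =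
        orderedProd (fun r => kerProjection (G (σ (t r)))) (j k) (j (k + K) - j k) := by
      rw [map_orderedProd]
      simp only [hP, toEuclideanCLM_kerMatrix]
    rwa [h4]
  have hS0 : 0 ≤ S := sub_nonneg.2 (hσ.strictMono.monotone hjk)
  have hS : ‖exp (S • Aᵀ)‖ ≤ c * Real.exp (b * Tc) ^ K := by
    rw [hexpT, ← Real.exp_nat_mul]
    refine (hexp S hS0).trans (mul_le_mul_of_nonneg_left (Real.exp_le_exp.2 ?_) (by linarith))
    have := mul_le_mul_of_nonneg_left (hconn.add_gap_le k K) hb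
    linarith
  have h5 : ‖Q * X (t (j k)) * exp (S • Aᵀ)‖ ≤ 1 / 4 * ‖X (t (j k))‖ := by
    have hδ0 := hδ.1.le
    calc _ ≤ ‖Q * X (t (j k))‖ * ‖exp (S • Aᵀ)‖ := Matrix.frobenius_norm_mul _ _
      _ ≤ (δ ^ K * ‖X (t (j k))‖) * (c * Real.exp (b * Tc) ^ K) := by
        gcongr
        refine (frobenius_norm_mul_le _ _).trans ?_
        gcongr
      _ = c * (δ * Real.exp (b * Tc)) ^ K * ‖X (t (j k))‖ := by rw [mul_pow]; ring
      _ ≤ _ := by gcongr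
  have h6 := norm_le_norm_add_norm_sub (Q * X (t (j k)) * exp (S • Aᵀ)) (X (t (j (k + K))))
  rw [norm_sub_rev] at h6
  have h7 := mul_le_mul_of_nonneg_right h2 (norm_nonneg (X (t (j k))))
  linarith

end blocks

section decay
variable {n m N n₀ : ℕ} {A : Matrix (Fin n) (Fin n) ℝ} {C : Matrix (Fin m) (Fin n) ℝ}
  {G : Fin n₀ → Digraph (Fin (N + 1))} {σ : ℝ → Fin n₀} {t : ℕ → ℝ} {τ : ℝ}
  {j : ℕ → ℕ} {Tc δ : ℝ}

/-- `X` solves the error dynamics `X' = X Aᵀ - H X Kᵀ` on `[0, ∞)`; the rows of `X` are the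
estimation errors of the followers. -/
structure IsErrorSolution (A K : Matrix (Fin n) (Fin n) ℝ) (G : Fin n₀ → Digraph (Fin (N + 1)))
    (σ : ℝ → Fin n₀) (X : ℝ → Matrix (Fin N) (Fin n) ℝ) : Prop where
  continuousOn : ContinuousOn X (Ici 0)
  deriv : ∀ s, 0 ≤ s → HasDerivWithinAt X
    (X s * Aᵀ - leaderFollowerMatrix (G (σ s)) * X s * Kᵀ) (Ici s) s

lemma exists_norm_le_exp_mul (A K : Matrix (Fin n) (Fin n) ℝ) (G : Fin n₀ → Digraph (Fin (N + 1)))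
    (σ : ℝ → Fin n₀) : ∃ β : ℝ, 0 ≤ β ∧ ∀ X, IsErrorSolution A K G σ X →
      ∀ a s, 0 ≤ a → a ≤ s → ‖X s‖ ≤ ‖X a‖ * Real.exp (β * (s - a)) := by
  refine ⟨‖Aᵀ‖ + (∑ p, ‖leaderFollowerMatrix (G p)‖) * ‖Kᵀ‖, by positivity, ?_⟩
  intro X hX a s ha has
  have h1 := norm_le_gronwallBound_of_norm_deriv_right_le (f := X) (δ := ‖X a‖) (ε := 0)
    (K := ‖Aᵀ‖ + (∑ p, ‖leaderFollowerMatrix (G p)‖) * ‖Kᵀ‖) (a := a) (b := s)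
    (hX.continuousOn.mono fun x hx => ha.trans hx.1) (fun x hx => hX.deriv x (ha.trans hx.1)) le_rfl
    (fun x _ => ?_) s (right_mem_Icc.2 has)
  · rwa [gronwallBound_ε0] at h1
  · have h2 : ‖leaderFollowerMatrix (G (σ x))‖ ≤ ∑ p, ‖leaderFollowerMatrix (G p)‖ :=
      Finset.single_le_sum (f := fun p => ‖leaderFollowerMatrix (G p)‖)
        (fun p _ => norm_nonneg _) (Finset.mem_univ (σ x))
    calc _ ≤ ‖X x * Aᵀ‖ + ‖leaderFollowerMatrix (G (σ x)) * X x * Kᵀ‖ := norm_sub_le _ _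
      _ ≤ ‖X x‖ * ‖Aᵀ‖ + ‖leaderFollowerMatrix (G (σ x))‖ * ‖X x‖ * ‖Kᵀ‖ := by
        refine add_le_add (Matrix.frobenius_norm_mul _ _) ((Matrix.frobenius_norm_mul _ _).trans ?_)
        gcongr
        exact Matrix.frobenius_norm_mul _ _
      _ ≤ ‖X x‖ * ‖Aᵀ‖ + (∑ p, ‖leaderFollowerMatrix (G p)‖) * ‖X x‖ * ‖Kᵀ‖ := by gcongr
      _ = _ := by ring

/-- Halving over blocks of bounded length gives exponential decay. -/
lemma exists_exp_decay_of_blocks (hσ : IsSwitchingSignal σ t τ)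
    (hconn : JointlyConnected G σ t j Tc) {A K : Matrix (Fin n) (Fin n) ℝ} {k₀ : ℕ} (hk₀ : 0 < k₀)
    (hhalf : ∀ X, IsErrorSolution A K G σ X → ∀ k,
      ‖X (t (j (k + k₀)))‖ ≤ 1 / 2 * ‖X (t (j k))‖) :
    ∃ M ρ : ℝ, 0 < M ∧ 0 < ρ ∧ ∀ X, IsErrorSolution A K G σ X → ∀ s, 0 ≤ s →
      ‖X s‖ ≤ M * Real.exp (-ρ * s) * ‖X 0‖ := by
  obtain ⟨β, hβ, hgrow⟩ := exists_norm_le_exp_mul A K G σ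
  have hTc := hconn.Tc_pos
  have hk₀' : (0 : ℝ) < k₀ := by exact_mod_cast hk₀
  set S := k₀ * Tc with hS
  have hS0 : 0 < S := by positivity
  refine ⟨2 * Real.exp (β * S), Real.log 2 / S, by positivity,
    div_pos (Real.log_pos one_lt_two) hS0, fun X hX s hs => ?_⟩
  set u : ℕ → ℝ := fun q => t (j (q * k₀)) with hu
  have hu0 : u 0 = 0 := by simp [hu, hconn.zero]
  have hulen : ∀ q, u (q + 1) - u q ≤ S := fun q => by
    have := hconn.add_gap_le (q * k₀) k₀
    simpa [hu, add_mul] using this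
  have hule : ∀ q : ℕ, u q ≤ q * S := fun q => by
    induction q with
    | zero => simp [hu0]
    | succ q ih => have := hulen q; push_cast; linarith
  have hunb : ∀ s, ∃ q, s < u q := fun s => by
    obtain ⟨r, hr⟩ := hσ.exists_lt s
    refine ⟨r, hr.trans_le (hσ.strictMono.monotone ?_)⟩
    exact (Nat.le_mul_of_pos_right r hk₀).trans hconn.strictMono.le_apply
  have hdec : ∀ q : ℕ, ‖X (u q)‖ ≤ (1 / 2) ^ q * ‖X 0‖ := fun q => by
    induction q with
    | zero => simp [hu0]
    | succ q ih =>
      have h1 := hhalf X hX (q * k₀)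
      have h2 : u (q + 1) = t (j (q * k₀ + k₀)) := by simp [hu, add_mul]
      rw [h2, pow_succ]
      linarith
  obtain ⟨q, hq⟩ := exists_mem_Ico_of_strictMono hu0 hunb hs
  have hq0 : 0 ≤ u q := hσ.nonneg _
  have h1 := hgrow X hX (u q) s hq0 hq.1
  have h2 : Real.exp (β * (s - u q)) ≤ Real.exp (β * S) := by
    refine Real.exp_le_exp.2 (mul_le_mul_of_nonneg_left ?_ hβ)
    linarith [hulen q, hq.2]
  have h3 : ((1 : ℝ) / 2) ^ q ≤ 2 * Real.exp (-(Real.log 2 / S) * s) := by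
    have h4 : ((1 : ℝ) / 2) ^ q = 2 * Real.exp (-(Real.log 2 * (q + 1))) := by
      have : Real.log 2 * ((q : ℝ) + 1) = ((q + 1 : ℕ) : ℝ) * Real.log 2 := by push_cast; ring
      rw [Real.exp_neg, this, Real.exp_nat_mul, Real.exp_log two_pos, pow_succ, one_div, inv_pow]
      field_simp
    rw [h4]
    gcongr
    have h5 : s ≤ (q + 1) * S := by
      have := hule (q + 1)
      push_cast at this
      linarith [hq.2]
    have h6 : s / S ≤ q + 1 := (div_le_iff₀ hS0).2 h5
    have h7 := mul_le_mul_of_nonneg_left h6 (Real.log_pos one_lt_two).le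
    have h8 : -(Real.log 2 / S) * s = -(Real.log 2 * (s / S)) := by ring
    linarith
  calc ‖X s‖ ≤ ‖X (u q)‖ * Real.exp (β * (s - u q)) := h1
    _ ≤ (2 * Real.exp (-(Real.log 2 / S) * s) * ‖X 0‖) * Real.exp (β * S) := by
      gcongr
      exact (hdec q).trans (by gcongr)
    _ = _ := by ring

/-- The error dynamics with the observer gain are exponentially stable for large `α`. -/
theorem exists_errorSolution_exp_decay (hG : ∀ p, Loopless (G p)) (hσ : IsSwitchingSignal σ t τ)
    (hund : ∀ s, 0 ≤ s → Undirected (followerGraph (G (σ s))))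
    (hconn : JointlyConnected G σ t j Tc) (hobs : Observable C A)
    (hδ : IsContractionFactor G σ t j δ) (hA : lambdaMax A < -Real.log δ / Tc) {T : ℝ}
    (hT : 0 < T) :
    ∃ α₀ : ℝ, 0 < α₀ ∧ ∀ α μ : ℝ, α₀ < α → 1 / lambdaH N ≤ μ →
      ∃ M ρ : ℝ, 0 < M ∧ 0 < ρ ∧ ∀ X, IsErrorSolution A (observerGain A C μ α T * C) G σ X →
        ∀ s, 0 ≤ s → ‖X s‖ ≤ M * Real.exp (-ρ * s) * ‖X 0‖ := by
  have hTc := hconn.Tc_pos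
  have hpos : 0 < -Real.log δ / Tc := div_pos (neg_pos.2 (Real.log_neg hδ.1 hδ.2.1)) hTc
  obtain ⟨b, hb1, hb2⟩ := exists_between (max_lt hA hpos)
  obtain ⟨hAb, hb⟩ := max_lt_iff.1 hb1
  obtain ⟨c, hc, hexp⟩ := exists_norm_exp_le A hAb
  have hc0 : 0 < c := by linarith
  have hq : δ * Real.exp (b * Tc) < 1 := by
    have h1 : b * Tc < -Real.log δ := (lt_div_iff₀ hTc).1 hb2
    calc δ * Real.exp (b * Tc) < δ * Real.exp (-Real.log δ) :=
          mul_lt_mul_of_pos_left (Real.exp_lt_exp.2 h1) hδ.1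
      _ = 1 := by rw [Real.exp_neg, Real.exp_log hδ.1, mul_inv_cancel₀ hδ.1.ne']
  obtain ⟨k₀, hk₀⟩ := exists_pow_lt_of_lt_one (show 0 < 1 / (4 * c) by positivity) hq
  have hk₀pos : 0 < k₀ := by
    rcases Nat.eq_zero_or_pos k₀ with h | h
    · rw [h, pow_zero, lt_div_iff₀ (by positivity)] at hk₀
      linarith
    · exact h
  have hK : c * (δ * Real.exp (b * Tc)) ^ k₀ ≤ 1 / 4 := by
    rw [lt_div_iff₀ (by positivity)] at hk₀
    linarith
  obtain ⟨κ, hκ, hdwell⟩ := exists_norm_sub_slow_part_le hobs hT hσ.dwell_pos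
  have hlim : Tendsto (fun α : ℝ => (c * Real.exp (b * Tc) + κ * Real.exp (-(α * τ / 2))) ^
      (k₀ * ⌊Tc / τ⌋₊) - (c * Real.exp (b * Tc)) ^ (k₀ * ⌊Tc / τ⌋₊)) atTop (𝓝 0) := by
    have h1 : Tendsto (fun α : ℝ => Real.exp (-(α * τ / 2))) atTop (𝓝 0) := by
      refine Real.tendsto_exp_neg_atTop_nhds_zero.comp ?_
      exact (tendsto_id.atTop_mul_const hσ.dwell_pos).atTop_div_const two_pos
    have h2 := (((h1.const_mul κ).const_add (c * Real.exp (b * Tc))).pow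
      (k₀ * ⌊Tc / τ⌋₊)).sub_const ((c * Real.exp (b * Tc)) ^ (k₀ * ⌊Tc / τ⌋₊))
    simpa using h2
  obtain ⟨α₁, hα₁⟩ := eventually_atTop.1 (hlim.eventually_le_const (show (0 : ℝ) < 1 / 4 by norm_num))
  refine ⟨max α₁ 1, by positivity, fun α μ hα hμ => ?_⟩
  have hα1 : α₁ ≤ α := ((le_max_left _ _).trans_lt hα).le
  have hα0 : 0 ≤ α := by linarith [(le_max_right α₁ 1).trans_lt hα]
  refine exists_exp_decay_of_blocks hσ hconn hk₀pos fun X hX k => ?_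
  refine norm_le_half_of_blocks hσ hconn hδ hb.le hc hexp hK
    (ε := κ * Real.exp (-(α * τ / 2))) (by positivity) (hα₁ α hα1) (fun r => ?_) k
  refine hdwell N _ α μ (hG _) (hund _ (hσ.nonneg r)) hα0 hμ X (t r) (t (r + 1))
    (by linarith [hσ.dwell r]) (hX.continuousOn.mono fun s hs => (hσ.nonneg r).trans hs.1)
    fun s hs => ?_
  rw [← hσ.const r s hs]
  exact hX.deriv s ((hσ.nonneg r).trans hs.1)

end decay

/-- Initial value problems for switched linear systems are solvable on `[0, ∞)`. -/
theorem exists_switched_solution {E : Type*} [NormedAddCommGroup E] [NormedSpace ℝ E]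
    [CompleteSpace E] (Λ : ℕ → E →L[ℝ] E) {t : ℕ → ℝ} (ht : StrictMono t) (h0 : t 0 = 0)
    (hunb : ∀ s, ∃ r, s < t r) (v : E) :
    ∃ X : ℝ → E, X 0 = v ∧ ContinuousOn X (Ici 0) ∧
      ∀ r, ∀ s ∈ Ico (t r) (t (r + 1)), HasDerivWithinAt X (Λ r (X s)) (Ici s) s := by
  classical
  let w : ℕ → E := fun r => Nat.rec v (fun r w => exp ((t (r + 1) - t r) • Λ r) w) r
  let φ : ℕ → ℝ → E := fun r s => exp ((s - t r) • Λ r) (w r)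
  have hφ0 : ∀ r, φ r (t r) = w r := fun r => by simp [φ]
  have hφ1 : ∀ r, φ r (t (r + 1)) = w (r + 1) := fun r => rfl
  have hφ : ∀ r s, HasDerivAt (φ r) (Λ r (φ r s)) s := fun r s => by
    have h1 : HasDerivAt (fun s : ℝ => exp ((s - t r) • Λ r)) (Λ r * exp ((s - t r) • Λ r)) s := by
      refine ((hasDerivAt_exp_smul_const' (Λ r) (s - t r)).scomp s
        ((hasDerivAt_id s).sub_const (t r))).congr_deriv (one_smul ℝ _)
    refine (h1.clm_apply (hasDerivAt_const s (w r))).congr_deriv ?_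
    simp [φ]
  have hidx : ∀ s, 0 ≤ s → ∃ r, s ∈ Ico (t r) (t (r + 1)) := fun s hs =>
    exists_mem_Ico_of_strictMono h0 hunb hs
  let X : ℝ → E := fun s => if hs : 0 ≤ s then φ (hidx s hs).choose s else 0
  have ht0 : ∀ r, 0 ≤ t r := fun r => h0 ▸ ht.monotone (Nat.zero_le r)
  have hX : ∀ r, ∀ s ∈ Ico (t r) (t (r + 1)), X s = φ r s := fun r s hs => by
    have hs0 : 0 ≤ s := (ht0 r).trans hs.1
    have h1 := (hidx s hs0).choose_spec
    have h2 : (hidx s hs0).choose = r := by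
      have h3 := ht.lt_iff_lt.1 (h1.1.trans_lt hs.2)
      have h4 := ht.lt_iff_lt.1 (hs.1.trans_lt h1.2)
      omega
    simp only [X, dif_pos hs0, h2]
  have hX' : ∀ r, ∀ s ∈ Icc (t r) (t (r + 1)), X s = φ r s := fun r s hs => by
    rcases eq_or_lt_of_le hs.2 with h | h
    · rw [h, hφ1 r, ← hφ0 (r + 1)]
      exact hX (r + 1) _ ⟨le_rfl, ht (Nat.lt_succ_self _)⟩
    · exact hX r s ⟨hs.1, h⟩
  have hderiv : ∀ r, ∀ s ∈ Ico (t r) (t (r + 1)),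
      HasDerivWithinAt X (Λ r (X s)) (Ici s) s := fun r s hs => by
    rw [hX r s hs]
    refine (hφ r s).hasDerivWithinAt.congr_of_eventuallyEq ?_ (hX r s hs)
    filter_upwards [Ico_mem_nhdsGE hs.2] with y hy
    exact hX r y ⟨hs.1.trans hy.1, hy.2⟩
  refine ⟨X, ?_, fun s hs => ?_, hderiv⟩
  · have h1 : (0 : ℝ) ∈ Ico (t 0) (t (0 + 1)) := ⟨h0.le, h0 ▸ ht Nat.zero_lt_one⟩
    rw [hX 0 0 h1]
    simp [φ, h0, w]
  · obtain ⟨r, hr⟩ := hidx s hs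
    have hright : ContinuousWithinAt X (Ici s) s := (hderiv r s hr).continuousWithinAt
    rcases eq_or_lt_of_le (show 0 ≤ s from hs) with h | h
    · rw [← h] at hright ⊢; exact hright
    obtain ⟨q, hq1, hq2⟩ : ∃ q, t q < s ∧ s ≤ t (q + 1) := by
      rcases eq_or_lt_of_le hr.1 with h' | h'
      · have hr0 : r ≠ 0 := by rintro rfl; rw [h0] at h'; exact h.ne h'
        obtain ⟨q, rfl⟩ := Nat.exists_eq_succ_of_ne_zero hr0
        exact ⟨q, h' ▸ ht (Nat.lt_succ_self q), h'.ge⟩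
      · exact ⟨r, h', hr.2.le⟩
    have hleft : ContinuousWithinAt X (Iic s) s := by
      refine (hφ q s).continuousAt.continuousWithinAt.congr_of_eventuallyEq ?_
        (hX' q s ⟨hq1.le, hq2⟩)
      filter_upwards [Ioc_mem_nhdsLE hq1] with y hy
      exact hX' q y ⟨hy.1.le, hy.2.trans hq2⟩
    exact (continuousAt_iff_continuous_left_right.2 ⟨hleft, hright⟩).continuousWithinAt

section observer
variable {n m N n₀ : ℕ} {A : Matrix (Fin n) (Fin n) ℝ} {C : Matrix (Fin m) (Fin n) ℝ}
  {G : Fin n₀ → Digraph (Fin (N + 1))} {σ : ℝ → Fin n₀} {t : ℕ → ℝ} {τ : ℝ}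
  {L : Matrix (Fin n) (Fin m) ℝ}

lemma hasDerivWithinAt_euclidean_iff {f : ℝ → EuclideanSpace ℝ (Fin n)}
    {f' : EuclideanSpace ℝ (Fin n)} {S : Set ℝ} {s : ℝ} :
    HasDerivWithinAt f f' S s ↔ ∀ k, HasDerivWithinAt (fun s => f s k) (f' k) S s := by
  simp only [hasDerivWithinAt_iff_hasFDerivWithinAt]
  rw [hasFDerivWithinAt_euclidean]
  refine forall_congr' fun k => ?_
  have : (EuclideanSpace.proj k : EuclideanSpace ℝ (Fin n) →L[ℝ] ℝ).comp
      (ContinuousLinearMap.toSpanSingleton ℝ f') =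
      ContinuousLinearMap.toSpanSingleton ℝ (f' k) := by
    ext; simp
  rw [← this]

lemma exists_errorSolution (hσ : IsSwitchingSignal σ t τ) (K : Matrix (Fin n) (Fin n) ℝ)
    (X₀ : Matrix (Fin N) (Fin n) ℝ) : ∃ X, IsErrorSolution A K G σ X ∧ X 0 = X₀ := by
  let Λ : ℕ → Matrix (Fin N) (Fin n) ℝ →ₗ[ℝ] Matrix (Fin N) (Fin n) ℝ := fun r =>
    { toFun := fun X => X * Aᵀ - leaderFollowerMatrix (G (σ (t r))) * X * Kᵀ
      map_add' := fun X Y => by simp only [Matrix.add_mul, Matrix.mul_add]; abel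
      map_smul' := fun c X => by
        simp only [Matrix.smul_mul, Matrix.mul_smul, smul_sub, RingHom.id_apply] }
  obtain ⟨X, h0, hc, hd⟩ := exists_switched_solution
    (fun r => LinearMap.toContinuousLinearMap (Λ r)) hσ.strictMono hσ.zero hσ.exists_lt X₀
  refine ⟨X, ⟨hc, fun s hs => ?_⟩, h0⟩
  obtain ⟨r, hr⟩ := exists_mem_Ico_of_strictMono hσ.zero hσ.exists_lt hs
  rw [hσ.const r s hr]
  exact hd r s hr

/-- The estimation errors, as the rows of a matrix. -/
def errorMatrix (x₀ : EuclideanSpace ℝ (Fin n)) (y : Fin N → EuclideanSpace ℝ (Fin n)) :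
    Matrix (Fin N) (Fin n) ℝ :=
  Matrix.of fun i k => y i k - x₀ k

lemma norm_errorMatrix (x₀ : EuclideanSpace ℝ (Fin n)) (y : Fin N → EuclideanSpace ℝ (Fin n)) :
    ‖errorMatrix x₀ y‖ = √(∑ i, ‖y i - x₀‖ ^ 2) := by
  rw [← Real.sqrt_sq (norm_nonneg (errorMatrix x₀ y)), frobenius_norm_sq]
  simp [EuclideanSpace.norm_sq_eq, errorMatrix]

/-- The observer equation, minus the leader equation, in terms of the error matrix. -/
lemma observer_field_apply {G : Digraph (Fin (N + 1))} (hG : Loopless G)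
    (K : Matrix (Fin n) (Fin n) ℝ) (x₀ : EuclideanSpace ℝ (Fin n))
    (y : Fin N → EuclideanSpace ℝ (Fin n)) (i : Fin N) (k : Fin n) :
    (Matrix.toEuclideanLin A (y i) + Matrix.toEuclideanLin K
      (∑ q : Fin (N + 1), adjacency G i.succ q •
        ((Fin.cons x₀ y : Fin (N + 1) → EuclideanSpace ℝ (Fin n)) q - y i))) k =
    (Matrix.toEuclideanLin A x₀) k +
      (errorMatrix x₀ y * Aᵀ - leaderFollowerMatrix G * errorMatrix x₀ y * Kᵀ) i k := by
  set E := errorMatrix x₀ y with hE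
  have h1 : ∀ l, (∑ q : Fin (N + 1), adjacency G i.succ q •
      ((Fin.cons x₀ y : Fin (N + 1) → EuclideanSpace ℝ (Fin n)) q - y i)) l =
      -(leaderFollowerMatrix G * E) i l := fun l => by
    have h2 : (leaderFollowerMatrix G * E) i l =
        (leaderFollowerMatrix G *ᵥ fun i => E i l) i := rfl
    rw [h2, leaderFollowerMatrix_mulVec hG, Fin.sum_univ_succ]
    simp only [Fin.cons_zero, Fin.cons_succ, PiLp.add_apply, PiLp.smul_apply, PiLp.sub_apply,
      smul_eq_mul, WithLp.ofLp_sum, Finset.sum_apply, adjacency_followerGraph, hE, errorMatrix,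
      Matrix.of_apply]
    rw [neg_add, ← Finset.sum_neg_distrib, add_comm]
    congr 1
    · exact Finset.sum_congr rfl fun q _ => by ring
    · ring
  have h3 : ∀ (B : Matrix (Fin n) (Fin n) ℝ) (z : EuclideanSpace ℝ (Fin n)),
      (Matrix.toEuclideanLin B z) k = ∑ l, B k l * z l := fun B z => by
    rw [Matrix.toLpLin_apply]; rfl
  have h4 : (E * Aᵀ) i k = (Matrix.toEuclideanLin A (y i)) k - (Matrix.toEuclideanLin A x₀) k := by
    rw [h3, h3, ← Finset.sum_sub_distrib, Matrix.mul_apply]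
    exact Finset.sum_congr rfl fun l _ => by simp [hE, errorMatrix]; ring
  have h5 : (leaderFollowerMatrix G * E * Kᵀ) i k = -(Matrix.toEuclideanLin K
      (∑ q : Fin (N + 1), adjacency G i.succ q •
        ((Fin.cons x₀ y : Fin (N + 1) → EuclideanSpace ℝ (Fin n)) q - y i))) k := by
    rw [h3, Matrix.mul_apply, ← Finset.sum_neg_distrib]
    refine Finset.sum_congr rfl fun l _ => ?_
    rw [h1, Matrix.transpose_apply]; ring
  rw [PiLp.add_apply, Matrix.sub_apply, h4, h5]
  ring

lemma cons_apply_eq (x₀ : ℝ → EuclideanSpace ℝ (Fin n)) (η : Fin N → ℝ → EuclideanSpace ℝ (Fin n))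
    (q : Fin (N + 1)) (s : ℝ) :
    (Fin.cons x₀ η : Fin (N + 1) → ℝ → EuclideanSpace ℝ (Fin n)) q s =
      (Fin.cons (x₀ s) fun i => η i s : Fin (N + 1) → EuclideanSpace ℝ (Fin n)) q := by
  refine Fin.cases ?_ (fun i => ?_) q <;> simp

lemma IsObserverSolution.isErrorSolution (hG : ∀ p, Loopless (G p))
    {x₀ : ℝ → EuclideanSpace ℝ (Fin n)} {η : Fin N → ℝ → EuclideanSpace ℝ (Fin n)}
    (h : IsObserverSolution A C G σ L x₀ η) :
    IsErrorSolution A (L * C) G σ fun s => errorMatrix (x₀ s) fun i => η i s := by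
  have hc : ContinuousOn x₀ (Ici 0) := fun s hs => (h.leader s hs).continuousWithinAt
  refine ⟨?_, fun s hs => ?_⟩
  · refine continuousOn_pi.2 fun i => continuousOn_pi.2 fun k => ?_
    exact ((EuclideanSpace.proj k).continuous.comp_continuousOn (h.continuousOn i)).sub
      ((EuclideanSpace.proj k).continuous.comp_continuousOn hc)
  · refine hasDerivWithinAt_matrix_iff.2 fun i k => ?_
    have h1 := hasDerivWithinAt_euclidean_iff.1 (h.observer i s hs) k
    have h2 := hasDerivWithinAt_euclidean_iff.1
      ((h.leader s hs).mono (Ici_subset_Ici.2 hs)) k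
    refine (h1.sub h2).congr_deriv ?_
    simp only [cons_apply_eq]
    exact sub_eq_of_eq_add' (observer_field_apply (hG (σ s)) (L * C) (x₀ s) (fun i => η i s) i k)

lemma exists_isObserverSolution (hG : ∀ p, Loopless (G p)) (hσ : IsSwitchingSignal σ t τ)
    (x₀init : EuclideanSpace ℝ (Fin n)) (ηinit : Fin N → EuclideanSpace ℝ (Fin n)) :
    ∃ x₀ η, IsObserverSolution A C G σ L x₀ η ∧ x₀ 0 = x₀init ∧ ∀ i, η i 0 = ηinit i := by
  obtain ⟨X, hX, hX0⟩ := exists_errorSolution (A := A) (G := G) hσ (L * C)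
    (errorMatrix x₀init ηinit)
  set x₀ : ℝ → EuclideanSpace ℝ (Fin n) := fun s =>
    WithLp.toLp 2 (exp (s • A) *ᵥ x₀init.ofLp) with hx₀
  set η : Fin N → ℝ → EuclideanSpace ℝ (Fin n) := fun i s =>
    x₀ s + WithLp.toLp 2 (X s i) with hη
  have hleader : ∀ s, HasDerivAt x₀ (Matrix.toEuclideanLin A (x₀ s)) s := fun s => by
    refine hasDerivWithinAt_univ.1 (hasDerivWithinAt_euclidean_iff.2 fun k => ?_)
    have h1 := (hasDerivWithinAt_matrix_iff (s := univ)).1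
      (hasDerivAt_exp_smul' A s).hasDerivWithinAt k
    have h2 := HasDerivWithinAt.fun_sum (u := Finset.univ) fun l _ =>
      (h1 l).mul_const (x₀init l)
    refine h2.congr_deriv ?_
    rw [Matrix.toLpLin_apply]
    simp only [hx₀, Matrix.mulVec_mulVec]
    rfl
  have hE : ∀ s, errorMatrix (x₀ s) (fun i => η i s) = X s := fun s => by
    ext i k; simp [errorMatrix, hη]
  refine ⟨x₀, η, ⟨fun s _ => (hleader s).hasDerivWithinAt, fun i => ?_, fun i s hs => ?_⟩, ?_,
    fun i => ?_⟩
  · refine ContinuousOn.add (fun s _ => (hleader s).continuousAt.continuousWithinAt) ?_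
    exact (PiLp.continuous_toLp 2 _).comp_continuousOn
      ((continuous_apply i).comp_continuousOn hX.continuousOn)
  · refine hasDerivWithinAt_euclidean_iff.2 fun k => ?_
    simp only [cons_apply_eq]
    refine HasDerivWithinAt.congr_deriv
      ((hasDerivWithinAt_euclidean_iff.1 (hleader s).hasDerivWithinAt k).add
        (hasDerivWithinAt_matrix_iff.1 (hX.deriv s hs) i k)) ?_
    rw [← hE s]
    exact (observer_field_apply (hG (σ s)) (L * C) (x₀ s) (fun i => η i s) i k).symm
  · simp [hx₀]
  · ext k
    simp [hη, hx₀, hX0, errorMatrix]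

lemma solvesObserverProblem_of_exp_decay (hG : ∀ p, Loopless (G p)) (hσ : IsSwitchingSignal σ t τ)
    (h : ∃ M ρ : ℝ, 0 < M ∧ 0 < ρ ∧ ∀ X, IsErrorSolution A (L * C) G σ X →
      ∀ s, 0 ≤ s → ‖X s‖ ≤ M * Real.exp (-ρ * s) * ‖X 0‖) :
    SolvesObserverProblem A C G σ L := by
  refine ⟨exists_isObserverSolution hG hσ, ?_⟩
  obtain ⟨M, ρ, hM, hρ, hdec⟩ := h
  refine ⟨M, ρ, hM, hρ, fun x₀ η hsol i s hs => ?_⟩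
  have h1 := hdec _ (hsol.isErrorSolution hG) s hs
  simp only [norm_errorMatrix] at h1
  refine le_trans ?_ h1
  refine Real.le_sqrt_of_sq_le ?_
  exact Finset.single_le_sum (f := fun i => ‖η i s - x₀ s‖ ^ 2) (fun i _ => sq_nonneg _)
    (Finset.mem_univ i)

end observer

end SwitchedObserver

end

theorem theorem2 {n m N n₀ : ℕ}
    (A : Matrix (Fin n) (Fin n) ℝ) (C : Matrix (Fin m) (Fin n) ℝ)
    (G : Fin n₀ → Digraph (Fin (N + 1))) (hG : ∀ p, SwitchedObserver.Loopless (G p))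
    (σ : ℝ → Fin n₀) (t : ℕ → ℝ) (τ : ℝ) (hσ : SwitchedObserver.IsSwitchingSignal σ t τ)
    (hund : ∀ s, 0 ≤ s →
      SwitchedObserver.Undirected (SwitchedObserver.followerGraph (G (σ s))))
    (j : ℕ → ℕ) (Tc : ℝ) (hconn : SwitchedObserver.JointlyConnected G σ t j Tc)
    (hobs : SwitchedObserver.Observable C A) :
    (∃ δ, SwitchedObserver.IsContractionFactor G σ t j δ) ∧
    (∀ α tstar : ℝ, 0 < α → 0 < tstar →
      (SwitchedObserver.weightedGramian A C α tstar).PosDef) ∧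
    ∀ δ, SwitchedObserver.IsContractionFactor G σ t j δ →
      SwitchedObserver.lambdaMax A < - Real.log δ / Tc →
      (∃ L, SwitchedObserver.SolvesObserverProblem A C G σ L) ∧
      ∀ tstar : ℝ, 0 < tstar → ∃ α₀ : ℝ, 0 < α₀ ∧
        ∀ α μ : ℝ, α₀ < α → 1 / SwitchedObserver.lambdaH N ≤ μ →
          SwitchedObserver.SolvesObserverProblem A C G σ
            (SwitchedObserver.observerGain A C μ α tstar) := by
  refine ⟨SwitchedObserver.exists_isContractionFactor hG hσ hund hconn,
    fun α tstar _ hT => SwitchedObserver.posDef_weightedGramian hobs α hT, fun δ hδ hA => ?_⟩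
  have key : ∀ tstar : ℝ, 0 < tstar → ∃ α₀ : ℝ, 0 < α₀ ∧
      ∀ α μ : ℝ, α₀ < α → 1 / SwitchedObserver.lambdaH N ≤ μ →
        SwitchedObserver.SolvesObserverProblem A C G σ
          (SwitchedObserver.observerGain A C μ α tstar) := fun tstar hT => by
    obtain ⟨α₀, hα₀, h⟩ :=
      SwitchedObserver.exists_errorSolution_exp_decay hG hσ hund hconn hobs hδ hA hT
    exact ⟨α₀, hα₀, fun α μ hα hμ =>
      SwitchedObserver.solvesObserverProblem_of_exp_decay hG hσ (h α μ hα hμ)⟩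
  refine ⟨?_, key⟩
  obtain ⟨α₀, _, h⟩ := key 1 one_pos
  exact ⟨_, h (α₀ + 1) _ (lt_add_one α₀) le_rfl⟩
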